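/- Let $N\ge 2$, $a\in\mathbb R$, and let $I,J\subseteq\mathbb R$ be open intervals. All functions are real-valued and $C^\infty$ on the indicated domains; $t\in I$, $x\in J$. Consider the finite lattice $$\partial^2_{tx}v_n=\partial_t v_n\,\partial_x v_n\left(\frac1{v_n-v_{n-1}}-\frac1{v_{n+1}-v_n}\right),\qquad 1\le n\le N-1,\qquad v_0=v_N=a, \tag{1}$$ for $v_1,\dots,v_{N-1}$ on $I\times J$, where it is understood that $v_n\ne v_{n+1}$ everywhere for $0\le n\le N-1$. Call a solution generic if $\partial_t v_n$ and $\partial_x v_n$ vanish nowhere for $1\le n\le N-2$. For functions $X_0,\dots,X_{N-2}$ of $x\in J$ and $T_0,\dots,T_{N-2}$ of $t\in I$ put $$\alpha_{ij}=\sum_{s=1}^{N-2}X_s^{(i)}T_s^{(j)},\qquad \beta_{kl}=\delta_{k1}T_0^{(l-1)}+\delta_{1l}X_0^{(k-1)}+\sum_{s=1}^{N-2}X_s^{(k-1)}T_s^{(l-1)},$$ and consider $$v_n=\frac{\det(\alpha_{ij})_{i,j=1}^{n-1}}{\det(\beta_{kl})_{k,l=1}^{n}}+a,\qquad 1\le n\le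 N-1. \tag{2}$$ 1. For all $X_s,T_s$ one has $\det(\alpha_{ij})_{i,j=1}^{N-1}=0$ on $I\times J$ (so that (2) for $n=N$ is consistent with $v_N=a$). If $\det(\beta_{kl})_{k,l=1}^{n}$ vanishes nowhere on $I\times J$ for $1\le n\le N-1$, and if the functions (2) together with $v_0=v_N=a$ satisfy $v_n\neq v_{n+1}$ everywhere for $0\le n\le N-1$, then they form a generic solution of (1). 2. Conversely, for every generic solution of (1) on $I\times J$ there are functions $X_0,\dots,X_{N-2}$ and $T_0,\dots,T_{N-2}$ such that, for $1\le n\le N-1$, $\det(\beta_{kl})_{k,l=1}^n$ vanishes nowhere and (2) holds on $I\times J$. 3. For a function $f(t,x)$ let $w_n(f)=\det(\partial_x^{i}\partial_t^{j}f)_{i,j=0}^{n-1}$, $w_0(f)=1$. If $u=X_0(x)+T_0(t)+\sum_{s=1}^{N-2}X_s(x)T_s(t)$ on $I\times J$, then $w_{N-1}(u_{tx})=0$. Conversely, if $u$ satisfies $w_{N-1}(u_{tx})=0$ and $w_{N-2}(u_{tx})\ne0$ everywhere on $I\times J$, then $u$ is of this form. -/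

import Mathlib

open scoped ContDiff

namespace FSY

/-- Partial derivative in the first variable `t` of a function `u(t, x)`. -/
noncomputable def partialT (u : ℝ → ℝ → ℝ) : ℝ → ℝ → ℝ :=
  fun t x => deriv (fun τ => u τ x) t

/-- Partial derivative in the second variable `x` of a function `u(t, x)`. -/
noncomputable def partialX (u : ℝ → ℝ → ℝ) : ℝ → ℝ → ℝ :=
  fun t x => deriv (fun ξ => u t ξ) x

/-- `u` is a smooth function of `(t, x)` on the open rectangle `I × J`. -/
def SmoothOn₂ (I J : Set ℝ) (u : ℝ → ℝ → ℝ) : Prop :=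
  ContDiffOn ℝ ∞ (fun p : ℝ × ℝ => u p.1 p.2) (I ×ˢ J)

/-- The determinant `w_n(u)` of the `n × n` matrix with entries `∂_x^i ∂_t^j u`,
`0 ≤ i, j ≤ n - 1`; in particular `w_0(u) = 1`. -/
noncomputable def w (n : ℕ) (u : ℝ → ℝ → ℝ) (t x : ℝ) : ℝ :=
  Matrix.det (Matrix.of fun i j : Fin n => (partialX^[(i : ℕ)] (partialT^[(j : ℕ)] u)) t x)

/-- The lattice equation for `v_n` (`n ≥ 1`) at the point `(t, x)`. -/
def LatticeEq (v : ℕ → ℝ → ℝ → ℝ) (n : ℕ) (t x : ℝ) : Prop :=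
  partialX (partialT (v n)) t x =
    partialT (v n) t x * partialX (v n) t x *
      (1 / (v n t x - v (n - 1) t x) - 1 / (v (n + 1) t x - v n t x))

/-- `v_0, …, v_N` satisfy on `I × J` the boundary condition `v_0 = v_N = a`, and neighbouring
components never coincide, so that no denominator of the lattice equations vanishes. -/
structure Admissible (N : ℕ) (a : ℝ) (I J : Set ℝ) (v : ℕ → ℝ → ℝ → ℝ) : Prop where
  left : ∀ t ∈ I, ∀ x ∈ J, v 0 t x = a
  right : ∀ t ∈ I, ∀ x ∈ J, v N t x = a
  ne : ∀ n < N, ∀ t ∈ I, ∀ x ∈ J, v n t x ≠ v (n + 1) t x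

/-- `v_0, …, v_N` is a smooth solution on `I × J` of the finite lattice with boundary condition
`v_0 = v_N = a`. -/
structure IsSolution (N : ℕ) (a : ℝ) (I J : Set ℝ) (v : ℕ → ℝ → ℝ → ℝ) : Prop
    extends Admissible N a I J v where
  smooth : ∀ n ≤ N, SmoothOn₂ I J (v n)
  eqn : ∀ n, 1 ≤ n → n + 1 ≤ N → ∀ t ∈ I, ∀ x ∈ J, LatticeEq v n t x

/-- Genericity: `∂_t v_n` and `∂_x v_n` vanish nowhere on `I × J` for `1 ≤ n ≤ N - 2`. -/
def Generic (N : ℕ) (I J : Set ℝ) (v : ℕ → ℝ → ℝ → ℝ) : Prop :=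
  ∀ n, 1 ≤ n → n + 2 ≤ N → ∀ t ∈ I, ∀ x ∈ J,
    partialT (v n) t x ≠ 0 ∧ partialX (v n) t x ≠ 0

/-- The functions `T_0, …, T_{N-2}` are smooth on `I`, and `X_0, …, X_{N-2}` are smooth on `J`. -/
def SmoothData (N : ℕ) (I J : Set ℝ) (X T : ℕ → ℝ → ℝ) : Prop :=
  ∀ s, s + 2 ≤ N → ContDiffOn ℝ ∞ (T s) I ∧ ContDiffOn ℝ ∞ (X s) J

/-- The `(n-1) × (n-1)` matrix `α_{ij}`, `i, j = 1, …, n - 1` (indices of `Fin` start at `0`). -/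
noncomputable def alpha (N : ℕ) (X T : ℕ → ℝ → ℝ) (n : ℕ) (t x : ℝ) :
    Matrix (Fin (n - 1)) (Fin (n - 1)) ℝ :=
  Matrix.of fun i j =>
    ∑ s ∈ Finset.Icc 1 (N - 2),
      iteratedDeriv ((i : ℕ) + 1) (X s) x * iteratedDeriv ((j : ℕ) + 1) (T s) t

/-- The `n × n` matrix `β_{kl}`, `k, l = 1, …, n` (indices of `Fin` start at `0`). -/
noncomputable def beta (N : ℕ) (X T : ℕ → ℝ → ℝ) (n : ℕ) (t x : ℝ) :
    Matrix (Fin n) (Fin n) ℝ :=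
  Matrix.of fun k l =>
    (if (k : ℕ) = 0 then iteratedDeriv (l : ℕ) (T 0) t else 0) +
    (if (l : ℕ) = 0 then iteratedDeriv (k : ℕ) (X 0) x else 0) +
    ∑ s ∈ Finset.Icc 1 (N - 2), iteratedDeriv (k : ℕ) (X s) x * iteratedDeriv (l : ℕ) (T s) t

/-- On `I × J`, for `1 ≤ n ≤ N - 1`: `det β` of size `n` does not vanish and
`v_n = det α / det β + a`. -/
def IsGivenBy (N : ℕ) (a : ℝ) (I J : Set ℝ) (X T : ℕ → ℝ → ℝ) (v : ℕ → ℝ → ℝ → ℝ) : Prop :=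
  ∀ n, 1 ≤ n → n + 1 ≤ N → ∀ t ∈ I, ∀ x ∈ J,
    (beta N X T n t x).det ≠ 0 ∧
    v n t x = (alpha N X T n t x).det / (beta N X T n t x).det + a

/-- On `I × J`: `u = X_0(x) + T_0(t) + ∑_{s=1}^{N-2} X_s(x) T_s(t)`. -/
def IsSeparatedSum (N : ℕ) (I J : Set ℝ) (X T : ℕ → ℝ → ℝ) (u : ℝ → ℝ → ℝ) : Prop :=
  ∀ t ∈ I, ∀ x ∈ J, u t x = X 0 x + T 0 t + ∑ s ∈ Finset.Icc 1 (N - 2), X s x * T s t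

end FSY

/-! Everything is expressed through one function, `u = 1/(v_1 - a)`, which for the given formulas is
`X_0 + T_0 + ∑ X_s T_s`. In the array of jets `∂_x^i ∂_t^j u`, let `τ_n`, `p_n`, `q_n`, `σ_n` be the
contiguous `n × n` minors starting at `(0,0)`, `(1,0)`, `(0,1)`, `(1,1)`. Then `det β = τ_n`, `det α
= σ_{n-1}`, and the formula reads `v_{n+1} = σ_n/τ_{n+1} + a` (`candidate`).

Jacobi's identity gives `v_{n+1} - v_n = p_n q_n/(τ_n τ_{n+1})`. Since differentiation shifts
indices, Jacobi and Plücker relations also factor the first derivatives of `v_{n+1}` and evaluate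
its mixed derivative. Substituting all this, the lattice equation at `n + 1` becomes the difference
formula at `n + 1`, provided the formula holds at `n` (`SmoothOn₂.latticeEq_iff`). At the right end
`v_N = a` amounts to `σ_{N-1} = 0`, which holds because `α` then factors through dimension `N - 2`.

Conversely, a generic solution satisfies the formula with `u = 1/(v_1 - a)` by induction on `n`:
genericity keeps `p_n`, `q_n`, and hence the next `τ`, away from zero. The last equation yields
`σ_{N-1} = 0`, and `v_{N-1} ≠ a` yields `σ_{N-2} ≠ 0`. The mixed jets of `u` therefore have rank `N
- 2`, and `SmoothOn₂.exists_separatedSum` separates the variables: coefficients of linear dependence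
between jets are constant, because the dependence survives differentiation. -/

namespace FSY

/-! ### Minors of an array: Schur complements, Jacobi and Plücker identities. -/

/-- The minor of the array `E` with rows `ρ` and columns `γ`. -/
noncomputable def minor {ι κ : Type*} (E : ι → κ → ℝ) {n : ℕ} (ρ : Fin n → ι) (γ : Fin n → κ) :
    ℝ :=
  Matrix.det (Matrix.of fun i j => E (ρ i) (γ j))

theorem minor_transpose {ι κ : Type*} (E : ι → κ → ℝ) {n : ℕ} (ρ : Fin n → ι) (γ : Fin n → κ) :
    minor (fun j i => E i j) γ ρ = minor E ρ γ := by
  unfold minor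
  rw [← Matrix.det_transpose]
  rfl

theorem minor_zero {ι κ : Type*} (E : ι → κ → ℝ) (ρ : Fin 0 → ι) (γ : Fin 0 → κ) :
    minor E ρ γ = 1 := by
  simp [minor]

/-- Moving the first row of a minor to the last place. -/
theorem minor_snoc_left {ι κ : Type*} (E : ι → κ → ℝ) {n : ℕ} (ρ : Fin n → ι) (a : ι)
    (γ : Fin (n + 1) → κ) :
    minor E (Fin.snoc ρ a : Fin (n + 1) → ι) γ
      = (-1) ^ n * minor E (Fin.cons a ρ : Fin (n + 1) → ι) γ := by
  have h := Matrix.det_permute (finRotate (n + 1))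
    (Matrix.of fun i j => E ((Fin.cons a ρ : Fin (n + 1) → ι) i) (γ j))
  rw [sign_finRotate] at h
  simp only [Nat.add_sub_cancel, Units.val_pow_eq_pow_val, Units.val_neg, Units.val_one,
    Int.cast_pow, Int.cast_neg, Int.cast_one] at h
  unfold minor
  rw [← h]
  congr 1
  ext i j
  simp [Matrix.submatrix, Fin.snoc_eq_cons_rotate]

/-- Moving the first column of a minor to the last place. -/
theorem minor_snoc_right {ι κ : Type*} (E : ι → κ → ℝ) {n : ℕ} (ρ : Fin (n + 1) → ι)
    (γ : Fin n → κ) (b : κ) :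
    minor E ρ (Fin.snoc γ b : Fin (n + 1) → κ)
      = (-1) ^ n * minor E ρ (Fin.cons b γ : Fin (n + 1) → κ) := by
  rw [← minor_transpose, minor_snoc_left, minor_transpose]

/-- A minor bordered by one row and column, as a block determinant. -/
theorem minor_snoc_eq_fromBlocks {ι κ : Type*} (E : ι → κ → ℝ) {n : ℕ}
    (ρ : Fin n → ι) (γ : Fin n → κ) (a : ι) (b : κ) :
    minor E (Fin.snoc ρ a : Fin (n + 1) → ι) (Fin.snoc γ b : Fin (n + 1) → κ)
      = (Matrix.fromBlocks (Matrix.of fun i j => E (ρ i) (γ j))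
          (Matrix.of fun i (_ : Fin 1) => E (ρ i) b) (Matrix.of fun (_ : Fin 1) j => E a (γ j))
          (Matrix.of fun (_ _ : Fin 1) => E a b)).det := by
  rw [minor, ← Matrix.det_submatrix_equiv_self (finSumFinEquiv (m := n) (n := 1))]
  have h1 : ∀ i : Fin n, Fin.castAdd 1 i = Fin.castSucc i := fun i => rfl
  have h2 : ∀ i : Fin 1, Fin.natAdd n i = Fin.last n := fun i => by ext; simp
  congr 1
  ext i j
  rcases i with i | i <;> rcases j with j | j <;>
    simp only [Matrix.submatrix_apply, finSumFinEquiv_apply_left, finSumFinEquiv_apply_right,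
      Matrix.of_apply, h1, h2, Fin.snoc_castSucc, Fin.snoc_last, Matrix.fromBlocks_apply₁₁,
      Matrix.fromBlocks_apply₁₂, Matrix.fromBlocks_apply₂₁, Matrix.fromBlocks_apply₂₂]

theorem minor_snoc_snoc_eq_fromBlocks {ι κ : Type*} (E : ι → κ → ℝ) {n : ℕ}
    (ρ : Fin n → ι) (γ : Fin n → κ) (a a' : ι) (b b' : κ) :
    minor E (Fin.snoc (Fin.snoc ρ a : Fin (n + 1) → ι) a' : Fin (n + 2) → ι)
        (Fin.snoc (Fin.snoc γ b : Fin (n + 1) → κ) b' : Fin (n + 2) → κ)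
      = (Matrix.fromBlocks (Matrix.of fun i j => E (ρ i) (γ j))
          (Matrix.of fun i (j : Fin 2) => E (ρ i) (![b, b'] j))
          (Matrix.of fun (i : Fin 2) j => E (![a, a'] i) (γ j))
          (Matrix.of fun (i j : Fin 2) => E (![a, a'] i) (![b, b'] j))).det := by
  rw [minor, ← Matrix.det_submatrix_equiv_self (finSumFinEquiv (m := n) (n := 2))]
  have h1 : ∀ i : Fin n, Fin.castAdd 2 i = Fin.castSucc (Fin.castSucc i) := fun i => rfl
  have h2 : Fin.natAdd n (0 : Fin 2) = Fin.castSucc (Fin.last n) := by ext; simp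
  have h3 : Fin.natAdd n (1 : Fin 2) = Fin.last (n + 1) := by ext; simp
  congr 1
  ext i j
  rcases i with i | i <;> rcases j with j | j <;> (try fin_cases i) <;> (try fin_cases j) <;>
    simp [h1, h2, h3]

/-- The entry of the Schur complement of the block with rows `ρ` and columns `γ`. -/
noncomputable def schurEntry {ι κ : Type*} (E : ι → κ → ℝ) {n : ℕ} (ρ : Fin n → ι)
    (γ : Fin n → κ) (a : ι) (b : κ) : ℝ :=
  E a b - (fun j => E a (γ j)) ⬝ᵥ ((Matrix.of fun i j => E (ρ i) (γ j))⁻¹.mulVec fun i => E (ρ i) b)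

/-- With an invertible core block, bordered minors are the core minor times minors of the Schur
complement. The identities below thereby reduce to polynomial identities in a few Schur entries. -/
theorem minor_snoc_eq_schurEntry {ι κ : Type*} (E : ι → κ → ℝ) {n : ℕ}
    (ρ : Fin n → ι) (γ : Fin n → κ) (h : minor E ρ γ ≠ 0) (a : ι) (b : κ) :
    minor E (Fin.snoc ρ a : Fin (n + 1) → ι) (Fin.snoc γ b : Fin (n + 1) → κ)
      = minor E ρ γ * schurEntry E ρ γ a b := by
  have hu : IsUnit (Matrix.of fun i j => E (ρ i) (γ j)) := by
    rw [Matrix.isUnit_iff_isUnit_det]; exact h.isUnit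
  let := hu.invertible
  rw [minor_snoc_eq_fromBlocks, Matrix.det_fromBlocks₁₁, Matrix.invOf_eq_nonsing_inv,
    Matrix.det_fin_one, minor, schurEntry, Matrix.mul_assoc]
  rfl

theorem minor_snoc_snoc_eq_schurEntry {ι κ : Type*} (E : ι → κ → ℝ) {n : ℕ}
    (ρ : Fin n → ι) (γ : Fin n → κ) (h : minor E ρ γ ≠ 0) (a a' : ι) (b b' : κ) :
    minor E (Fin.snoc (Fin.snoc ρ a : Fin (n + 1) → ι) a' : Fin (n + 2) → ι)
        (Fin.snoc (Fin.snoc γ b : Fin (n + 1) → κ) b' : Fin (n + 2) → κ)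
      = minor E ρ γ * (schurEntry E ρ γ a b * schurEntry E ρ γ a' b'
          - schurEntry E ρ γ a b' * schurEntry E ρ γ a' b) := by
  have hu : IsUnit (Matrix.of fun i j => E (ρ i) (γ j)) := by
    rw [Matrix.isUnit_iff_isUnit_det]; exact h.isUnit
  let := hu.invertible
  rw [minor_snoc_snoc_eq_fromBlocks, Matrix.det_fromBlocks₁₁, Matrix.invOf_eq_nonsing_inv,
    Matrix.det_fin_two, minor, Matrix.mul_assoc]
  rfl

/-- The determinant is the characteristic polynomial of `-A` at `ε`, so only finitely many `ε` are
excluded. -/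
theorem dense_setOf_det_add_smul_one_ne_zero {n : ℕ} (A : Matrix (Fin n) (Fin n) ℝ) :
    Dense {ε : ℝ | (A + ε • (1 : Matrix (Fin n) (Fin n) ℝ)).det ≠ 0} := by
  have hfin : {ε : ℝ | (-A).charpoly.IsRoot ε}.Finite :=
    Polynomial.finite_setOfPred_isRoot (Matrix.charpoly_monic _).ne_zero
  have hd := hfin.countable.dense_compl ℝ
  refine hd.mono fun ε hε => ?_
  simp only [Set.mem_compl_iff, Set.mem_ofPred_eq, Polynomial.IsRoot,
    Matrix.eval_charpoly] at hε ⊢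
  rwa [sub_neg_eq_add, add_comm, Matrix.scalar_apply, ← Matrix.smul_one_eq_diagonal] at hε

/-- Two continuous expressions in the entries agree once they agree when the block with rows `ρ`
and columns `γ` is invertible. -/
theorem minor_identity_of_generic {ι κ : Type*} (E : ι → κ → ℝ) {n : ℕ}
    (ρ : Fin n → ι) (γ : Fin n → κ)
    (P : ((Fin n ⊕ ι) → (Fin n ⊕ κ) → ℝ) → ℝ) (hP : Continuous P)
    (h : ∀ F, minor F (Sum.inl : Fin n → Fin n ⊕ ι) (Sum.inl : Fin n → Fin n ⊕ κ) ≠ 0 → P F = 0) :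
    P (fun i j => E (Sum.elim ρ id i) (Sum.elim γ id j)) = 0 := by
  classical
  -- The core rows and columns get fresh labels from `Fin n`, so that `ε • 1` can be added to the
  -- core block alone, even when `ρ` or `γ` repeats an index or meets a bordering one.
  set F : ℝ → (Fin n ⊕ ι) → (Fin n ⊕ κ) → ℝ := fun ε i j =>
    E (Sum.elim ρ id i) (Sum.elim γ id j) + ε * (Matrix.fromBlocks 1 0 0 0 :
      Matrix (Fin n ⊕ ι) (Fin n ⊕ κ) ℝ) i j with hF
  have hc : Continuous fun ε => P (F ε) := by
    refine hP.comp ?_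
    simp only [hF]
    fun_prop
  have hz : (fun ε => P (F ε)) = fun _ => 0 := by
    refine Continuous.ext_on (dense_setOf_det_add_smul_one_ne_zero
      (Matrix.of fun i j => E (ρ i) (γ j))) hc continuous_const fun ε hε => h _ ?_
    have : minor (F ε) Sum.inl Sum.inl
        = ((Matrix.of fun i j => E (ρ i) (γ j)) + ε • (1 : Matrix (Fin n) (Fin n) ℝ)).det := rfl
    rw [this]
    exact hε
  have := congrFun hz 0
  simpa [hF] using this

theorem continuous_minor {ι κ : Type*} {n : ℕ} (ρ : Fin n → ι) (γ : Fin n → κ) :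
    Continuous fun E : ι → κ → ℝ => minor E ρ γ := by
  unfold minor
  refine Continuous.matrix_det (continuous_matrix fun i j => ?_)
  simp only [Matrix.of_apply]
  fun_prop

theorem minor_comp {ι κ ι' κ' : Type*} (E : ι → κ → ℝ) {n : ℕ} (f : ι' → ι) (g : κ' → κ)
    (ρ : Fin n → ι') (γ : Fin n → κ') :
    minor (fun i j => E (f i) (g j)) ρ γ = minor E (f ∘ ρ) (g ∘ γ) := rfl

/-- The Desnanot–Jacobi identity. -/
theorem minor_jacobi {ι κ : Type*} (E : ι → κ → ℝ) {n : ℕ}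
    (ρ : Fin n → ι) (γ : Fin n → κ) (a a' : ι) (b b' : κ) :
    minor E (Fin.snoc (Fin.snoc ρ a : Fin (n + 1) → ι) a' : Fin (n + 2) → ι)
        (Fin.snoc (Fin.snoc γ b : Fin (n + 1) → κ) b' : Fin (n + 2) → κ) * minor E ρ γ
      = minor E (Fin.snoc ρ a : Fin (n + 1) → ι) (Fin.snoc γ b : Fin (n + 1) → κ)
          * minor E (Fin.snoc ρ a' : Fin (n + 1) → ι) (Fin.snoc γ b' : Fin (n + 1) → κ)
        - minor E (Fin.snoc ρ a : Fin (n + 1) → ι) (Fin.snoc γ b' : Fin (n + 1) → κ)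
          * minor E (Fin.snoc ρ a' : Fin (n + 1) → ι) (Fin.snoc γ b : Fin (n + 1) → κ) := by
  have key := minor_identity_of_generic E ρ γ
    (fun F => minor F (Fin.snoc (Fin.snoc Sum.inl (Sum.inr a) : Fin (n + 1) → _) (Sum.inr a') :
          Fin (n + 2) → _)
        (Fin.snoc (Fin.snoc Sum.inl (Sum.inr b) : Fin (n + 1) → _) (Sum.inr b') : Fin (n + 2) → _)
          * minor F Sum.inl Sum.inl
      - (minor F (Fin.snoc Sum.inl (Sum.inr a) : Fin (n + 1) → _)
            (Fin.snoc Sum.inl (Sum.inr b) : Fin (n + 1) → _)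
          * minor F (Fin.snoc Sum.inl (Sum.inr a') : Fin (n + 1) → _)
            (Fin.snoc Sum.inl (Sum.inr b') : Fin (n + 1) → _)
        - minor F (Fin.snoc Sum.inl (Sum.inr a) : Fin (n + 1) → _)
            (Fin.snoc Sum.inl (Sum.inr b') : Fin (n + 1) → _)
          * minor F (Fin.snoc Sum.inl (Sum.inr a') : Fin (n + 1) → _)
            (Fin.snoc Sum.inl (Sum.inr b) : Fin (n + 1) → _)))
    (by
      refine ((continuous_minor _ _).mul (continuous_minor _ _)).sub
        (((continuous_minor _ _).mul (continuous_minor _ _)).sub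
          ((continuous_minor _ _).mul (continuous_minor _ _))))
    (fun F hF => by
      simp only [minor_snoc_eq_schurEntry F _ _ hF, minor_snoc_snoc_eq_schurEntry F _ _ hF]
      ring)
  simp only [minor_comp, Fin.comp_snoc, Sum.elim_comp_inl, Sum.elim_inr, id_eq] at key
  linarith [key]

/-- The three-term Plücker relation. -/
theorem minor_plucker {ι κ : Type*} (E : ι → κ → ℝ) {n : ℕ}
    (ρ : Fin n → ι) (γ : Fin n → κ) (a a' a'' : ι) (b b' : κ) :
    minor E (Fin.snoc ρ a : Fin (n + 1) → ι) (Fin.snoc γ b : Fin (n + 1) → κ)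
        * minor E (Fin.snoc (Fin.snoc ρ a' : Fin (n + 1) → ι) a'' : Fin (n + 2) → ι)
          (Fin.snoc (Fin.snoc γ b : Fin (n + 1) → κ) b' : Fin (n + 2) → κ)
      - minor E (Fin.snoc ρ a' : Fin (n + 1) → ι) (Fin.snoc γ b : Fin (n + 1) → κ)
        * minor E (Fin.snoc (Fin.snoc ρ a : Fin (n + 1) → ι) a'' : Fin (n + 2) → ι)
          (Fin.snoc (Fin.snoc γ b : Fin (n + 1) → κ) b' : Fin (n + 2) → κ)
      + minor E (Fin.snoc ρ a'' : Fin (n + 1) → ι) (Fin.snoc γ b : Fin (n + 1) → κ)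
        * minor E (Fin.snoc (Fin.snoc ρ a : Fin (n + 1) → ι) a' : Fin (n + 2) → ι)
          (Fin.snoc (Fin.snoc γ b : Fin (n + 1) → κ) b' : Fin (n + 2) → κ) = 0 := by
  have key := minor_identity_of_generic E ρ γ
    (fun F =>
      minor F (Fin.snoc Sum.inl (Sum.inr a) : Fin (n + 1) → _)
          (Fin.snoc Sum.inl (Sum.inr b) : Fin (n + 1) → _)
        * minor F (Fin.snoc (Fin.snoc Sum.inl (Sum.inr a') : Fin (n + 1) → _) (Sum.inr a'') :
            Fin (n + 2) → _)
          (Fin.snoc (Fin.snoc Sum.inl (Sum.inr b) : Fin (n + 1) → _) (Sum.inr b') :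
            Fin (n + 2) → _)
      - minor F (Fin.snoc Sum.inl (Sum.inr a') : Fin (n + 1) → _)
          (Fin.snoc Sum.inl (Sum.inr b) : Fin (n + 1) → _)
        * minor F (Fin.snoc (Fin.snoc Sum.inl (Sum.inr a) : Fin (n + 1) → _) (Sum.inr a'') :
            Fin (n + 2) → _)
          (Fin.snoc (Fin.snoc Sum.inl (Sum.inr b) : Fin (n + 1) → _) (Sum.inr b') :
            Fin (n + 2) → _)
      + minor F (Fin.snoc Sum.inl (Sum.inr a'') : Fin (n + 1) → _)
          (Fin.snoc Sum.inl (Sum.inr b) : Fin (n + 1) → _)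
        * minor F (Fin.snoc (Fin.snoc Sum.inl (Sum.inr a) : Fin (n + 1) → _) (Sum.inr a') :
            Fin (n + 2) → _)
          (Fin.snoc (Fin.snoc Sum.inl (Sum.inr b) : Fin (n + 1) → _) (Sum.inr b') :
            Fin (n + 2) → _))
    (by
      refine (((continuous_minor _ _).mul (continuous_minor _ _)).sub
        ((continuous_minor _ _).mul (continuous_minor _ _))).add
          ((continuous_minor _ _).mul (continuous_minor _ _)))
    (fun F hF => by
      simp only [minor_snoc_eq_schurEntry F _ _ hF, minor_snoc_snoc_eq_schurEntry F _ _ hF]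
      ring)
  simp only [minor_comp, Fin.comp_snoc, Sum.elim_comp_inl, Sum.elim_inr, id_eq] at key
  exact key

/-! ### Identities between contiguous minors and their bumped versions. -/

/-- The segment `r, r + 1, …, r + n - 1` of indices. -/
def seg (r n : ℕ) : Fin n → ℕ := fun i => r + i

theorem seg_succ_eq_snoc (r n : ℕ) : seg r (n + 1) = Fin.snoc (seg r n) (r + n) := by
  ext i
  refine Fin.lastCases ?_ (fun i => ?_) i <;> simp [seg]

theorem seg_succ_eq_cons (r n : ℕ) : seg r (n + 1) = Fin.cons r (seg (r + 1) n) := by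
  ext i
  refine Fin.cases ?_ (fun i => ?_) i <;> simp [seg]; omega

/-- The minor with contiguous rows `r, …, r + n - 1` and columns `c, …, c + n - 1`. -/
noncomputable def cminor (E : ℕ → ℕ → ℝ) (r c n : ℕ) : ℝ := minor E (seg r n) (seg c n)

/-- The contiguous minor with its last row replaced by the next one; zero for the empty minor. -/
noncomputable def bumpedMinor (E : ℕ → ℕ → ℝ) (r c : ℕ) : ℕ → ℝ
  | 0 => 0
  | n + 1 => minor E (Fin.snoc (seg r n) (r + n + 1) : Fin (n + 1) → ℕ) (seg c (n + 1))

theorem cminor_zero (E : ℕ → ℕ → ℝ) (r c : ℕ) : cminor E r c 0 = 1 := minor_zero _ _ _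

theorem cminor_transpose (E : ℕ → ℕ → ℝ) (r c n : ℕ) :
    cminor (fun j i => E i j) c r n = cminor E r c n := minor_transpose _ _ _

theorem neg_one_pow_mul_self (k : ℕ) : ((-1 : ℝ) ^ k) * (-1) ^ k = 1 := by
  rw [← mul_pow]; simp

/-- Jacobi's identity for the core `1, …, k`, bordered by `k + 1` and by `0` in both rows and
columns. Moving `0` to the front costs signs that cancel in pairs. This identity produces the
consecutive differences of the candidate. -/
theorem cminor_jacobi (E : ℕ → ℕ → ℝ) (k : ℕ) :
    cminor E 1 1 (k + 1) * cminor E 0 0 (k + 1) - cminor E 1 1 k * cminor E 0 0 (k + 2)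
      = cminor E 1 0 (k + 1) * cminor E 0 1 (k + 1) := by
  have h := minor_jacobi E (seg 1 k) (seg 1 k) (1 + k) 0 (1 + k) 0
  simp only [← seg_succ_eq_snoc, minor_snoc_left, minor_snoc_right] at h
  simp only [← seg_succ_eq_cons 0] at h
  change (-1) ^ (k + 1) * ((-1) ^ (k + 1) * cminor E 0 0 (k + 2)) * cminor E 1 1 k
    = cminor E 1 1 (k + 1) * ((-1) ^ k * ((-1) ^ k * cminor E 0 0 (k + 1)))
      - (-1) ^ k * cminor E 1 0 (k + 1) * ((-1) ^ k * cminor E 0 1 (k + 1)) at h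
  linear_combination (cminor E 1 1 (k + 1) * cminor E 0 0 (k + 1)
    - cminor E 1 0 (k + 1) * cminor E 0 1 (k + 1)
    - cminor E 1 1 k * cminor E 0 0 (k + 2)) * (-neg_one_pow_mul_self k) - h

theorem cons_snoc_seg (r k c : ℕ) :
    (Fin.cons r (Fin.snoc (seg (r + 1) k) c : Fin (k + 1) → ℕ) : Fin (k + 2) → ℕ)
      = Fin.snoc (seg r (k + 1)) c := by
  rw [seg_succ_eq_cons, Fin.cons_snoc_eq_snoc_cons]

theorem bumpedMinor_one (E : ℕ → ℕ → ℝ) (r c : ℕ) :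
    bumpedMinor E r c 1 = cminor E (r + 1) c 1 := by
  rw [bumpedMinor, cminor, seg_succ_eq_snoc (r + 1)]
  congr 1

/-- Numerator of the row derivative of `cminor E 1 1 n / cminor E 0 0 (n + 1)`. -/
theorem bumpedMinor_quotient (E : ℕ → ℕ → ℝ) (n : ℕ) :
    bumpedMinor E 1 1 n * cminor E 0 0 (n + 1) - cminor E 1 1 n * bumpedMinor E 0 0 (n + 1)
      = - (cminor E 0 1 n * cminor E 1 0 (n + 1)) := by
  rcases n with _ | k
  · simp only [zero_add, bumpedMinor_one, cminor_zero]
    simp [bumpedMinor]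
  -- Core `1, …, k` in rows and columns; adjoined rows `k + 1`, `k + 2`, `0` and adjoined columns `k
  -- + 1`, `0`.
  have h := minor_plucker E (seg 1 k) (seg 1 k) (1 + k) (1 + k + 1) 0 (1 + k) 0
  simp only [← seg_succ_eq_snoc 1 k] at h
  rw [show 1 + k + 1 = 1 + (k + 1) by ring, ← seg_succ_eq_snoc 1 (k + 1),
    show 1 + (k + 1) = 1 + k + 1 by ring] at h
  simp only [minor_snoc_right _ _ (seg 1 (k + 1)) 0] at h
  rw [minor_snoc_left E (Fin.snoc (seg 1 k) (1 + k + 1)) 0, minor_snoc_left E (seg 1 k) 0,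
    minor_snoc_left E (seg 1 (k + 1)) 0] at h
  simp only [cons_snoc_seg 0, ← seg_succ_eq_cons 0] at h
  -- The bumped row is `k + 2` in both minors, but `bumpedMinor` unfolds to `0 + (k + 1) + 1` in one
  -- and to `1 + k + 1` in the other; each `change` needs its own form.
  rw [show 1 + k + 1 = 0 + (k + 1) + 1 by ring] at h
  change cminor E 1 1 (k + 1) * ((-1) ^ (k + 1) * ((-1) ^ (k + 1) * bumpedMinor E 0 0 (k + 2)))
    - minor E (Fin.snoc (seg 1 k) (0 + (k + 1) + 1) : Fin (k + 1) → ℕ) (seg 1 (k + 1))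
      * ((-1) ^ (k + 1) * ((-1) ^ (k + 1) * cminor E 0 0 (k + 2)))
    + (-1) ^ k * cminor E 0 1 (k + 1) * ((-1) ^ (k + 1) * cminor E 1 0 (k + 2)) = 0 at h
  rw [show 0 + (k + 1) + 1 = 1 + k + 1 by ring] at h
  change cminor E 1 1 (k + 1) * ((-1) ^ (k + 1) * ((-1) ^ (k + 1) * bumpedMinor E 0 0 (k + 2)))
    - bumpedMinor E 1 1 (k + 1) * ((-1) ^ (k + 1) * ((-1) ^ (k + 1) * cminor E 0 0 (k + 2)))
    + (-1) ^ k * cminor E 0 1 (k + 1) * ((-1) ^ (k + 1) * cminor E 1 0 (k + 2)) = 0 at h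
  linear_combination (-h) - (cminor E 0 1 (k + 1) * cminor E 1 0 (k + 2)
    + bumpedMinor E 1 1 (k + 1) * cminor E 0 0 (k + 2)
    - cminor E 1 1 (k + 1) * bumpedMinor E 0 0 (k + 2)) * neg_one_pow_mul_self k

/-- This and `bumpedMinor_right` are the numerators, up to sign, of the row derivatives of
`p_n/τ_{n+1}` and `q_{n+1}/τ_{n+1}`, the two factors of `∂_t v_{n+1}`. Here the Plücker relation has
core rows `1, …, k`, core columns `0, …, k - 1`, adjoined rows `k + 1`, `k + 2`, `0` and adjoined
columns `k`, `k + 1`. -/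
theorem bumpedMinor_left (E : ℕ → ℕ → ℝ) (n : ℕ) :
    bumpedMinor E 0 0 (n + 1) * cminor E 1 0 n - bumpedMinor E 1 0 n * cminor E 0 0 (n + 1)
      = cminor E 1 0 (n + 1) * cminor E 0 0 n := by
  rcases n with _ | k
  · simp only [zero_add, bumpedMinor_one, cminor_zero]
    simp [bumpedMinor]
  have h := minor_plucker E (seg 1 k) (seg 0 k) (1 + k) (1 + k + 1) 0 (0 + k) (0 + (k + 1))
  simp only [← seg_succ_eq_snoc 1 k, ← seg_succ_eq_snoc 0 k] at h
  rw [show 1 + k + 1 = 1 + (k + 1) by ring, ← seg_succ_eq_snoc 1 (k + 1),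
    show 1 + (k + 1) = 1 + k + 1 by ring] at h
  simp only [← seg_succ_eq_snoc 0 (k + 1)] at h
  rw [minor_snoc_left E (Fin.snoc (seg 1 k) (1 + k + 1)) 0, minor_snoc_left E (seg 1 k) 0,
    minor_snoc_left E (seg 1 (k + 1)) 0] at h
  simp only [cons_snoc_seg 0, ← seg_succ_eq_cons 0] at h
  rw [show 1 + k + 1 = 0 + (k + 1) + 1 by ring] at h
  change cminor E 1 0 (k + 1) * ((-1) ^ (k + 1) * bumpedMinor E 0 0 (k + 2))
    - minor E (Fin.snoc (seg 1 k) (0 + (k + 1) + 1) : Fin (k + 1) → ℕ) (seg 0 (k + 1))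
      * ((-1) ^ (k + 1) * cminor E 0 0 (k + 2))
    + (-1) ^ k * cminor E 0 0 (k + 1) * cminor E 1 0 (k + 2) = 0 at h
  rw [show 0 + (k + 1) + 1 = 1 + k + 1 by ring] at h
  change cminor E 1 0 (k + 1) * ((-1) ^ (k + 1) * bumpedMinor E 0 0 (k + 2))
    - bumpedMinor E 1 0 (k + 1) * ((-1) ^ (k + 1) * cminor E 0 0 (k + 2))
    + (-1) ^ k * cminor E 0 0 (k + 1) * cminor E 1 0 (k + 2) = 0 at h
  linear_combination (-(-1) ^ k * h) - (bumpedMinor E 0 0 (k + 2) * cminor E 1 0 (k + 1)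
    - bumpedMinor E 1 0 (k + 1) * cminor E 0 0 (k + 2)
    - cminor E 1 0 (k + 2) * cminor E 0 0 (k + 1)) * neg_one_pow_mul_self k

/-- Jacobi's identity with core rows `0, …, k - 1` bordered by `k`, `k + 1`, and core columns `1, …,
k` bordered by `k + 1`, `0`. -/
theorem bumpedMinor_right (E : ℕ → ℕ → ℝ) (k : ℕ) :
    bumpedMinor E 0 1 (k + 1) * cminor E 0 0 (k + 1)
        - bumpedMinor E 0 0 (k + 1) * cminor E 0 1 (k + 1)
      = cminor E 0 1 k * cminor E 0 0 (k + 2) := by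
  have h := minor_jacobi E (seg 0 k) (seg 1 k) (0 + k) (0 + (k + 1)) (1 + k) 0
  simp only [← seg_succ_eq_snoc 0 k, ← seg_succ_eq_snoc 1 k, ← seg_succ_eq_snoc 0 (k + 1),
    minor_snoc_right _ _ (seg 1 (k + 1)) 0, minor_snoc_right _ _ (seg 1 k) 0,
    ← seg_succ_eq_cons 0] at h
  change (-1) ^ (k + 1) * cminor E 0 0 (k + 2) * cminor E 0 1 k
    = cminor E 0 1 (k + 1) * ((-1) ^ k * bumpedMinor E 0 0 (k + 1))
      - (-1) ^ k * cminor E 0 0 (k + 1) * bumpedMinor E 0 1 (k + 1) at h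
  linear_combination (-1) ^ k * h + (cminor E 0 1 k * cminor E 0 0 (k + 2)
    + bumpedMinor E 0 0 (k + 1) * cminor E 0 1 (k + 1)
    - bumpedMinor E 0 1 (k + 1) * cminor E 0 0 (k + 1)) * neg_one_pow_mul_self k

/-! ### Derivatives of contiguous minors. -/

/-- The derivative of a determinant, by columns. -/
theorem hasDerivAt_det {n : ℕ} {A : ℝ → Matrix (Fin n) (Fin n) ℝ} {A' : Matrix (Fin n) (Fin n) ℝ}
    {s : ℝ} (h : ∀ i j, HasDerivAt (fun z => A z i j) (A' i j) s) :
    HasDerivAt (fun z => (A z).det) (∑ k, ((A s).updateCol k fun i => A' i k).det) s := by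
  simp only [Matrix.det_apply']
  have h1 : ∀ σ : Equiv.Perm (Fin n), HasDerivAt
      (fun z => ((Equiv.Perm.sign σ : ℤ) : ℝ) * ∏ i, A z (σ i) i)
      (((Equiv.Perm.sign σ : ℤ) : ℝ)
        * ∑ k, (∏ j ∈ Finset.univ.erase k, A s (σ j) j) • A' (σ k) k) s := fun σ =>
    (HasDerivAt.fun_finsetProd fun i _ => h (σ i) i).const_mul _
  have h2 := HasDerivAt.fun_sum (u := Finset.univ) fun σ _ => h1 σ
  convert! h2 using 1
  rw [Finset.sum_comm]
  refine Finset.sum_congr rfl fun σ _ => ?_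
  rw [Finset.mul_sum]
  refine Finset.sum_congr rfl fun k _ => ?_
  congr 1
  rw [← Finset.prod_erase_mul _ _ (Finset.mem_univ k), smul_eq_mul]
  congr 1
  · refine Finset.prod_congr rfl fun j hj => ?_
    rw [Matrix.updateCol_ne (Finset.ne_of_mem_erase hj)]
  · rw [Matrix.updateCol_self]

/-- If differentiation shifts the row index, it bumps the last row of a contiguous minor. -/
theorem hasDerivAt_cminor {E : ℝ → ℕ → ℕ → ℝ} {s : ℝ}
    (h : ∀ i j, HasDerivAt (fun z => E z i j) (E s (i + 1) j) s) (r c n : ℕ) :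
    HasDerivAt (fun z => cminor (E z) r c n) (bumpedMinor (E s) r c n) s := by
  rcases n with _ | n
  · simp only [cminor_zero, bumpedMinor]
    exact hasDerivAt_const s 1
  have h1 := hasDerivAt_det (s := s)
    (A := fun z => Matrix.of fun j i => E z (seg r (n + 1) i) (seg c (n + 1) j))
    (A' := Matrix.of fun j i => E s (seg r (n + 1) i + 1) (seg c (n + 1) j))
    (fun j i => h _ _)
  have h2 : ∀ z, cminor (E z) r c (n + 1)
      = (Matrix.of fun j i => E z (seg r (n + 1) i) (seg c (n + 1) j)).det := fun z =>
    (minor_transpose (E z) _ _).symm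
  simp only [h2]
  convert! h1 using 1
  -- Differentiating any row but the last turns it into a copy of the row after it, so only the last
  -- term survives. The matrix is transposed because `hasDerivAt_det` works by columns.
  rw [Fin.sum_univ_castSucc, Finset.sum_eq_zero, zero_add]
  · rw [bumpedMinor, ← minor_transpose, minor]
    congr 1
    ext j i
    refine Fin.lastCases ?_ (fun i => ?_) i
    · simp [seg]
    · rw [Matrix.updateCol_ne (Fin.castSucc_lt_last i).ne]
      simp [seg]
  · intro k _
    refine Matrix.det_zero_of_column_eq (i := k.castSucc) (j := k.succ)
      (Fin.castSucc_lt_succ).ne fun j => ?_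
    rw [Matrix.updateCol_self, Matrix.updateCol_ne (Fin.castSucc_lt_succ).ne']
    simp [seg, add_assoc]

end FSY

/-! ### Smooth functions on a rectangle and their jets. -/

namespace FSY

variable {I J : Set ℝ} {u v : ℝ → ℝ → ℝ}

theorem SmoothOn₂.contDiffAt (hI : IsOpen I) (hJ : IsOpen J) (hu : SmoothOn₂ I J u) {t x : ℝ}
    (ht : t ∈ I) (hx : x ∈ J) : ContDiffAt ℝ ∞ (fun p : ℝ × ℝ => u p.1 p.2) (t, x) :=
  ContDiffOn.contDiffAt hu ((hI.prod hJ).mem_nhds (Set.mk_mem_prod ht hx))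

theorem SmoothOn₂.hasDerivAt_fst (hI : IsOpen I) (hJ : IsOpen J) (hu : SmoothOn₂ I J u) {t x : ℝ}
    (ht : t ∈ I) (hx : x ∈ J) :
    HasDerivAt (fun τ => u τ x) (fderiv ℝ (fun p : ℝ × ℝ => u p.1 p.2) (t, x) (1, 0)) t :=
  ((hu.contDiffAt hI hJ ht hx).differentiableAt (by simp)).hasFDerivAt.comp_hasDerivAt
    (f := fun τ => (τ, x)) t ((hasDerivAt_id t).prodMk (hasDerivAt_const t x))

theorem SmoothOn₂.hasDerivAt_snd (hI : IsOpen I) (hJ : IsOpen J) (hu : SmoothOn₂ I J u) {t x : ℝ}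
    (ht : t ∈ I) (hx : x ∈ J) :
    HasDerivAt (fun ξ => u t ξ) (fderiv ℝ (fun p : ℝ × ℝ => u p.1 p.2) (t, x) (0, 1)) x :=
  ((hu.contDiffAt hI hJ ht hx).differentiableAt (by simp)).hasFDerivAt.comp_hasDerivAt
    (f := fun ξ => (t, ξ)) x ((hasDerivAt_const x t).prodMk (hasDerivAt_id x))

theorem SmoothOn₂.partialT_eq (hI : IsOpen I) (hJ : IsOpen J) (hu : SmoothOn₂ I J u) {t x : ℝ}
    (ht : t ∈ I) (hx : x ∈ J) :
    partialT u t x = fderiv ℝ (fun p : ℝ × ℝ => u p.1 p.2) (t, x) (1, 0) :=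
  (hu.hasDerivAt_fst hI hJ ht hx).deriv

theorem SmoothOn₂.partialX_eq (hI : IsOpen I) (hJ : IsOpen J) (hu : SmoothOn₂ I J u) {t x : ℝ}
    (ht : t ∈ I) (hx : x ∈ J) :
    partialX u t x = fderiv ℝ (fun p : ℝ × ℝ => u p.1 p.2) (t, x) (0, 1) :=
  (hu.hasDerivAt_snd hI hJ ht hx).deriv

theorem SmoothOn₂.hasDerivAt_partialT (hI : IsOpen I) (hJ : IsOpen J) (hu : SmoothOn₂ I J u)
    {t x : ℝ} (ht : t ∈ I) (hx : x ∈ J) :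
    HasDerivAt (fun τ => u τ x) (partialT u t x) t := by
  rw [hu.partialT_eq hI hJ ht hx]
  exact hu.hasDerivAt_fst hI hJ ht hx

theorem SmoothOn₂.hasDerivAt_partialX (hI : IsOpen I) (hJ : IsOpen J) (hu : SmoothOn₂ I J u)
    {t x : ℝ} (ht : t ∈ I) (hx : x ∈ J) :
    HasDerivAt (fun ξ => u t ξ) (partialX u t x) x := by
  rw [hu.partialX_eq hI hJ ht hx]
  exact hu.hasDerivAt_snd hI hJ ht hx

theorem SmoothOn₂.congr (hu : SmoothOn₂ I J u) (h : ∀ t ∈ I, ∀ x ∈ J, v t x = u t x) :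
    SmoothOn₂ I J v :=
  ContDiffOn.congr hu fun p hp => h p.1 hp.1 p.2 hp.2

theorem SmoothOn₂.partialT (hI : IsOpen I) (hJ : IsOpen J) (hu : SmoothOn₂ I J u) :
    SmoothOn₂ I J (partialT u) := by
  have h : ContDiffOn ℝ ∞ (fderiv ℝ (fun p : ℝ × ℝ => u p.1 p.2)) (I ×ˢ J) :=
    ContDiffOn.fderiv_of_isOpen hu (hI.prod hJ) (by simp)
  exact (h.clm_apply contDiffOn_const).congr fun p hp => hu.partialT_eq hI hJ hp.1 hp.2

theorem SmoothOn₂.partialX (hI : IsOpen I) (hJ : IsOpen J) (hu : SmoothOn₂ I J u) :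
    SmoothOn₂ I J (partialX u) := by
  have h : ContDiffOn ℝ ∞ (fderiv ℝ (fun p : ℝ × ℝ => u p.1 p.2)) (I ×ˢ J) :=
    ContDiffOn.fderiv_of_isOpen hu (hI.prod hJ) (by simp)
  exact (h.clm_apply contDiffOn_const).congr fun p hp => hu.partialX_eq hI hJ hp.1 hp.2

theorem partialT_congr (hI : IsOpen I) (h : ∀ t ∈ I, ∀ x ∈ J, v t x = u t x) :
    ∀ t ∈ I, ∀ x ∈ J, partialT v t x = partialT u t x := fun _ ht x hx =>
  Filter.EventuallyEq.deriv_eq <| Filter.mem_of_superset (hI.mem_nhds ht) fun τ hτ => h τ hτ x hx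

theorem partialX_congr (hJ : IsOpen J) (h : ∀ t ∈ I, ∀ x ∈ J, v t x = u t x) :
    ∀ t ∈ I, ∀ x ∈ J, partialX v t x = partialX u t x := fun t ht _ hx =>
  Filter.EventuallyEq.deriv_eq <| Filter.mem_of_superset (hJ.mem_nhds hx) fun ξ hξ => h t ht ξ hξ

theorem SmoothOn₂.partialT_partialX (hI : IsOpen I) (hJ : IsOpen J) (hu : SmoothOn₂ I J u) :
    ∀ t ∈ I, ∀ x ∈ J, FSY.partialT (FSY.partialX u) t x = FSY.partialX (FSY.partialT u) t x := by
  intro t ht x hx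
  set U := fun p : ℝ × ℝ => u p.1 p.2
  have hc := hu.contDiffAt hI hJ ht hx
  have hd : DifferentiableAt ℝ (fderiv ℝ U) (t, x) :=
    (hc.fderiv_right (m := 1) (by norm_cast)).differentiableAt (by simp)
  have h1 := (hu.partialX hI hJ).partialT_eq hI hJ ht hx
  have h2 := (hu.partialT hI hJ).partialX_eq hI hJ ht hx
  have hn := (hI.prod hJ).mem_nhds (Set.mk_mem_prod ht hx)
  have e1 : (fun p : ℝ × ℝ => FSY.partialX u p.1 p.2) =ᶠ[nhds (t, x)]
      fun p => fderiv ℝ U p (0, 1) :=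
    Filter.mem_of_superset hn fun p hp => hu.partialX_eq hI hJ hp.1 hp.2
  have e2 : (fun p : ℝ × ℝ => FSY.partialT u p.1 p.2) =ᶠ[nhds (t, x)]
      fun p => fderiv ℝ U p (1, 0) :=
    Filter.mem_of_superset hn fun p hp => hu.partialT_eq hI hJ hp.1 hp.2
  rw [h1, h2, e1.fderiv_eq, e2.fderiv_eq,
    (hd.hasFDerivAt.clm_apply (hasFDerivAt_const _ _)).fderiv,
    (hd.hasFDerivAt.clm_apply (hasFDerivAt_const _ _)).fderiv]
  simpa using hc.isSymmSndFDerivAt (by simpa using ENat.LEInfty.out) (1, 0) (0, 1)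

/-- The mixed partial derivative `∂_x^i ∂_t^j u`. -/
noncomputable def jet (u : ℝ → ℝ → ℝ) (i j : ℕ) : ℝ → ℝ → ℝ := partialX^[i] (partialT^[j] u)

theorem SmoothOn₂.jet (hI : IsOpen I) (hJ : IsOpen J) (hu : SmoothOn₂ I J u) (i j : ℕ) :
    SmoothOn₂ I J (jet u i j) := by
  unfold FSY.jet
  have h : SmoothOn₂ I J (FSY.partialT^[j] u) := by
    induction j with
    | zero => exact hu
    | succ j ih => rw [Function.iterate_succ_apply']; exact ih.partialT hI hJ
  induction i with
  | zero => exact h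
  | succ i ih => rw [Function.iterate_succ_apply']; exact ih.partialX hI hJ

theorem partialX_jet (u : ℝ → ℝ → ℝ) (i j : ℕ) : partialX (jet u i j) = jet u (i + 1) j :=
  (Function.iterate_succ_apply' _ _ _).symm

/-- In `jet` the `t`-derivatives are taken first, so raising the `x`-order is definitional while
raising the `t`-order requires commuting the partial derivatives. -/
theorem SmoothOn₂.partialT_jet (hI : IsOpen I) (hJ : IsOpen J) (hu : SmoothOn₂ I J u) (i j : ℕ) :
    ∀ t ∈ I, ∀ x ∈ J, FSY.partialT (FSY.jet u i j) t x = FSY.jet u i (j + 1) t x := by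
  induction i with
  | zero =>
    intro t _ x _
    exact congrFun (congrFun (Function.iterate_succ_apply' FSY.partialT j u).symm t) x
  | succ i ih =>
    intro t ht x hx
    rw [← partialX_jet, (hu.jet hI hJ i j).partialT_partialX hI hJ t ht x hx,
      partialX_congr hJ ih t ht x hx, partialX_jet]

theorem jet_congr (hI : IsOpen I) (hJ : IsOpen J) (h : ∀ t ∈ I, ∀ x ∈ J, v t x = u t x)
    (i j : ℕ) : ∀ t ∈ I, ∀ x ∈ J, jet v i j t x = jet u i j t x := by
  unfold jet
  induction i with
  | zero =>
    induction j with
    | zero => exact h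
    | succ j ih =>
      simp only [Function.iterate_succ_apply', Function.iterate_zero, id_eq] at ih ⊢
      exact partialT_congr hI ih
  | succ i ih =>
    simp only [Function.iterate_succ_apply']
    exact partialX_congr hJ ih

theorem SmoothOn₂.jet_partialX (hI : IsOpen I) (hJ : IsOpen J) (hu : SmoothOn₂ I J u) (i j : ℕ) :
    ∀ t ∈ I, ∀ x ∈ J, FSY.jet (FSY.partialX u) i j t x = FSY.jet u (i + 1) j t x := by
  have h : ∀ t ∈ I, ∀ x ∈ J, (FSY.partialT^[j] (FSY.partialX u)) t x = FSY.jet u 1 j t x := by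
    induction j with
    | zero => intro t _ x _; rfl
    | succ j ih =>
      intro t ht x hx
      rw [Function.iterate_succ_apply', partialT_congr hI ih t ht x hx,
        hu.partialT_jet hI hJ 1 j t ht x hx]
  intro t ht x hx
  have h2 := jet_congr hI hJ h i 0 t ht x hx
  refine h2.trans (congrFun (congrFun ?_ t) x)
  exact (Function.iterate_add_apply FSY.partialX i 1 _).symm

theorem SmoothOn₂.jet_mixed (hI : IsOpen I) (hJ : IsOpen J) (hu : SmoothOn₂ I J u) (i j : ℕ) :
    ∀ t ∈ I, ∀ x ∈ J, FSY.jet (FSY.partialX (FSY.partialT u)) i j t x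
      = FSY.jet u (i + 1) (j + 1) t x := fun t ht x hx =>
  (hu.partialT hI hJ).jet_partialX hI hJ i j t ht x hx

/-- The array of mixed partial derivatives of `u` at a point. -/
noncomputable def jetArray (u : ℝ → ℝ → ℝ) (t x : ℝ) (i j : ℕ) : ℝ := jet u i j t x

theorem SmoothOn₂.hasDerivAt_jetArray_snd (hI : IsOpen I) (hJ : IsOpen J) (hu : SmoothOn₂ I J u)
    {t x : ℝ} (ht : t ∈ I) (hx : x ∈ J) (i j : ℕ) :
    HasDerivAt (fun ξ => jetArray u t ξ i j) (jetArray u t x (i + 1) j) x := by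
  have h := (hu.jet hI hJ i j).hasDerivAt_partialX hI hJ ht hx
  rwa [partialX_jet] at h

theorem SmoothOn₂.hasDerivAt_jetArray_fst (hI : IsOpen I) (hJ : IsOpen J) (hu : SmoothOn₂ I J u)
    {t x : ℝ} (ht : t ∈ I) (hx : x ∈ J) (i j : ℕ) :
    HasDerivAt (fun τ => jetArray u τ x i j) (jetArray u t x i (j + 1)) t := by
  have h := (hu.jet hI hJ i j).hasDerivAt_partialT hI hJ ht hx
  rwa [hu.partialT_jet hI hJ i j t ht x hx] at h

theorem SmoothOn₂.w_mixed_eq_cminor (hI : IsOpen I) (hJ : IsOpen J) (hu : SmoothOn₂ I J u) (n : ℕ)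
    {t x : ℝ} (ht : t ∈ I) (hx : x ∈ J) :
    w n (FSY.partialX (FSY.partialT u)) t x = cminor (jetArray u t x) 1 1 n := by
  unfold w cminor minor seg jetArray
  congr 1
  ext i j
  have h := hu.jet_mixed hI hJ i j t ht x hx
  simpa [add_comm 1, FSY.jet] using h

theorem contDiffOn_det {E : Type*} [NormedAddCommGroup E] [NormedSpace ℝ E] {s : Set E} {n : ℕ}
    {A : E → Matrix (Fin n) (Fin n) ℝ} (h : ∀ i j, ContDiffOn ℝ ∞ (fun p => A p i j) s) :
    ContDiffOn ℝ ∞ (fun p => (A p).det) s := by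
  simp only [Matrix.det_apply']
  exact ContDiffOn.sum fun σ _ => contDiffOn_const.mul (contDiffOn_prod fun i _ => h _ _)

theorem SmoothOn₂.cminor (hI : IsOpen I) (hJ : IsOpen J) (hu : SmoothOn₂ I J u) (r c n : ℕ) :
    SmoothOn₂ I J fun t x => cminor (jetArray u t x) r c n :=
  contDiffOn_det (A := fun p : ℝ × ℝ => Matrix.of fun i j : Fin n =>
    jetArray u p.1 p.2 (seg r n i) (seg c n j)) fun _ _ => hu.jet hI hJ _ _

/-! ### Partial derivatives of the candidate solution. -/

section LatticeCandidate

/-- The candidate solution `σ_n / τ_{n+1} + a` built from the jets of `u`. -/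
noncomputable def candidate (u : ℝ → ℝ → ℝ) (a : ℝ) (n : ℕ) (t x : ℝ) : ℝ :=
  cminor (jetArray u t x) 1 1 n / cminor (jetArray u t x) 0 0 (n + 1) + a

variable {a : ℝ} {n : ℕ}

theorem SmoothOn₂.candidate (hI : IsOpen I) (hJ : IsOpen J) (hu : SmoothOn₂ I J u)
    (hτ : ∀ t ∈ I, ∀ x ∈ J, FSY.cminor (jetArray u t x) 0 0 (n + 1) ≠ 0) :
    SmoothOn₂ I J (candidate u a n) :=
  ((hu.cminor hI hJ 1 1 n).div (hu.cminor hI hJ 0 0 (n + 1)) fun p hp => hτ p.1 hp.1 p.2 hp.2).add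
    contDiffOn_const

theorem SmoothOn₂.partialX_candidate (hI : IsOpen I) (hJ : IsOpen J) (hu : SmoothOn₂ I J u)
    {t x : ℝ} (ht : t ∈ I) (hx : x ∈ J) (hτ : FSY.cminor (jetArray u t x) 0 0 (n + 1) ≠ 0) :
    FSY.partialX (FSY.candidate u a n) t x
      = -(FSY.cminor (jetArray u t x) 0 1 n * FSY.cminor (jetArray u t x) 1 0 (n + 1))
        / FSY.cminor (jetArray u t x) 0 0 (n + 1) ^ 2 := by
  have h := hu.hasDerivAt_jetArray_snd hI hJ ht hx
  have hd := ((hasDerivAt_cminor (E := fun ξ => jetArray u t ξ) h 1 1 n).div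
    (hasDerivAt_cminor (E := fun ξ => jetArray u t ξ) h 0 0 (n + 1)) hτ).add_const a
  rw [← bumpedMinor_quotient]
  exact hd.deriv

/-- Differentiation in `t` shifts columns; transposing the jet array turns this into the row case
and exchanges `p` with `q`. -/
theorem SmoothOn₂.partialT_candidate (hI : IsOpen I) (hJ : IsOpen J) (hu : SmoothOn₂ I J u)
    {t x : ℝ} (ht : t ∈ I) (hx : x ∈ J) (hτ : FSY.cminor (jetArray u t x) 0 0 (n + 1) ≠ 0) :
    FSY.partialT (FSY.candidate u a n) t x
      = -(FSY.cminor (jetArray u t x) 1 0 n * FSY.cminor (jetArray u t x) 0 1 (n + 1))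
        / FSY.cminor (jetArray u t x) 0 0 (n + 1) ^ 2 := by
  have h := hu.hasDerivAt_jetArray_fst hI hJ ht hx
  have hd : ∀ r c k, HasDerivAt (fun τ => FSY.cminor (jetArray u τ x) r c k)
      (bumpedMinor (fun j i => jetArray u t x i j) c r k) t := fun r c k => by
    have := hasDerivAt_cminor (E := fun τ j i => jetArray u τ x i j) (fun j i => h i j) c r k
    simpa only [cminor_transpose] using this
  have hq := bumpedMinor_quotient (fun j i => jetArray u t x i j) n
  simp only [cminor_transpose] at hq
  rw [← hq]
  exact (((hd 1 1 n).div (hd 0 0 (n + 1)) hτ).add_const a).deriv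

/-- The product rule for `∂_t v_{n+1} = -(p_n/τ_{n+1})(q_{n+1}/τ_{n+1})`, with `bumpedMinor_left`
and `bumpedMinor_right` evaluating the two factors. -/
theorem SmoothOn₂.mixed_candidate (hI : IsOpen I) (hJ : IsOpen J) (hu : SmoothOn₂ I J u)
    (hτ : ∀ t ∈ I, ∀ x ∈ J, FSY.cminor (jetArray u t x) 0 0 (n + 1) ≠ 0) :
    ∀ t ∈ I, ∀ x ∈ J, FSY.partialX (FSY.partialT (FSY.candidate u a n)) t x
      = (FSY.cminor (jetArray u t x) 0 1 (n + 1) * FSY.cminor (jetArray u t x) 1 0 (n + 1)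
            * FSY.cminor (jetArray u t x) 0 0 n
          - FSY.cminor (jetArray u t x) 1 0 n * FSY.cminor (jetArray u t x) 0 1 n
            * FSY.cminor (jetArray u t x) 0 0 (n + 2))
        / FSY.cminor (jetArray u t x) 0 0 (n + 1) ^ 3 := by
  intro t ht x hx
  rw [partialX_congr hJ (fun t ht x hx => hu.partialT_candidate (a := a) hI hJ ht hx (hτ t ht x hx))
    t ht x hx]
  have h := hu.hasDerivAt_jetArray_snd hI hJ ht hx
  have hd := fun r c k => hasDerivAt_cminor (E := fun ξ => jetArray u t ξ) h r c k
  have h0 := hτ t ht x hx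
  have hD := (((hd 1 0 n).mul (hd 0 1 (n + 1))).neg.div ((hd 0 0 (n + 1)).pow 2)
    (pow_ne_zero 2 h0)).deriv
  refine hD.trans ?_
  have hl := bumpedMinor_left (jetArray u t x) n
  have hr := bumpedMinor_right (jetArray u t x) n
  simp only [Pi.mul_apply, Pi.neg_apply, Pi.pow_apply]
  rw [div_eq_div_iff (by positivity) (by positivity)]
  push_cast
  linear_combination FSY.cminor (jetArray u t x) 0 0 (n + 1) ^ 4
    * (FSY.cminor (jetArray u t x) 0 1 (n + 1) * hl - FSY.cminor (jetArray u t x) 1 0 n * hr)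

end LatticeCandidate

end FSY

/-! ### Separation of variables for jets of constant rank. -/

namespace FSY

theorem differentiableAt_det {n : ℕ} {A : ℝ → Matrix (Fin n) (Fin n) ℝ} {s : ℝ}
    (h : ∀ i j, DifferentiableAt ℝ (fun z => A z i j) s) :
    DifferentiableAt ℝ (fun z => (A z).det) s :=
  (hasDerivAt_det (A' := Matrix.of fun i j => deriv (fun z => A z i j) s)
    fun i j => (h i j).hasDerivAt).differentiableAt

theorem differentiableAt_inv_apply {n : ℕ} {A : ℝ → Matrix (Fin n) (Fin n) ℝ} {s : ℝ}
    (h : ∀ i j, DifferentiableAt ℝ (fun z => A z i j) s) (hdet : (A s).det ≠ 0) (i j : Fin n) :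
    DifferentiableAt ℝ (fun z => (A z)⁻¹ i j) s := by
  simp only [Matrix.inv_def, Matrix.smul_apply, smul_eq_mul, Ring.inverse_eq_inv',
    Matrix.adjugate_apply]
  refine ((differentiableAt_det h).inv hdet).mul (differentiableAt_det fun k l => ?_)
  simp only [Matrix.updateRow_apply]
  split_ifs
  · exact differentiableAt_const _
  · exact h k l

/-- The solution `c` of a linear system `M c = y` with `M' c = y'` is constant. -/
theorem inv_mulVec_eq_of_deriv {n : ℕ} {K : Set ℝ} (hKo : IsOpen K) (hK : K.OrdConnected)
    {M M' : ℝ → Matrix (Fin n) (Fin n) ℝ} {y y' : ℝ → Fin n → ℝ}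
    (hM : ∀ s ∈ K, ∀ i j, HasDerivAt (fun z => M z i j) (M' s i j) s)
    (hy : ∀ s ∈ K, ∀ i, HasDerivAt (fun z => y z i) (y' s i) s)
    (hdet : ∀ s ∈ K, (M s).det ≠ 0)
    (h : ∀ s ∈ K, (M' s).mulVec ((M s)⁻¹.mulVec (y s)) = y' s) :
    ∀ s ∈ K, ∀ s₀ ∈ K, (M s)⁻¹.mulVec (y s) = (M s₀)⁻¹.mulVec (y s₀) := by
  set c : ℝ → Fin n → ℝ := fun s => (M s)⁻¹.mulVec (y s) with hc
  have hMc : ∀ s ∈ K, (M s).mulVec (c s) = y s := fun s hs => by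
    rw [hc, Matrix.mulVec_mulVec, Matrix.mul_nonsing_inv _ (hdet s hs).isUnit, Matrix.one_mulVec]
  have hcd : ∀ s ∈ K, ∀ i, DifferentiableAt ℝ (fun z => c z i) s := fun s hs i => by
    simp only [hc, Matrix.mulVec, dotProduct]
    exact DifferentiableAt.fun_sum fun j _ =>
      (differentiableAt_inv_apply (fun k l => (hM s hs k l).differentiableAt) (hdet s hs) i j).mul
        (hy s hs j).differentiableAt
  -- Differentiating `M c = y` and subtracting `M' c = y'` leaves `M c' = 0`.
  have hc0 : ∀ s ∈ K, ∀ i, deriv (fun z => c z i) s = 0 := fun s hs => by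
    have hz : (M s).mulVec (fun i => deriv (fun z => c z i) s) = 0 := by
      ext i
      have h1 : HasDerivAt (fun z => ∑ j, M z i j * c z j)
          (∑ j, (M' s i j * c s j + M s i j * deriv (fun z => c z j) s)) s :=
        HasDerivAt.fun_sum fun j _ => (hM s hs i j).mul (hcd s hs j).hasDerivAt
      have h2 : (fun z => ∑ j, M z i j * c z j) =ᶠ[nhds s] fun z => y z i :=
        Filter.mem_of_superset (hKo.mem_nhds hs) fun z hz => congrFun (hMc z hz) i
      have h3 := (h1.congr_of_eventuallyEq h2.symm).unique (hy s hs i)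
      rw [Finset.sum_add_distrib] at h3
      have h4 : ∑ j, M' s i j * c s j = y' s i := congrFun (h s hs) i
      have : ∑ j, M s i j * deriv (fun z => c z j) s = 0 := by linarith
      exact this
    exact fun i => congrFun (Matrix.eq_zero_of_mulVec_eq_zero (hdet s hs) hz) i
  intro s hs s₀ hs₀
  ext i
  exact hKo.is_const_of_deriv_eq_zero hK.isPreconnected
    (fun z hz => (hcd z hz i).differentiableWithinAt) (fun z hz => hc0 z hz i) hs hs₀

variable {I J : Set ℝ} {u : ℝ → ℝ → ℝ}

theorem SmoothOn₂.contDiffOn_fst (hu : SmoothOn₂ I J u) {x : ℝ} (hx : x ∈ J) :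
    ContDiffOn ℝ ∞ (fun t => u t x) I :=
  ContDiffOn.comp (g := fun p : ℝ × ℝ => u p.1 p.2) (f := fun t => (t, x)) hu
    (contDiffOn_id.prodMk contDiffOn_const) fun _ ht => ⟨ht, hx⟩

theorem SmoothOn₂.contDiffOn_snd (hu : SmoothOn₂ I J u) {t : ℝ} (ht : t ∈ I) :
    ContDiffOn ℝ ∞ (fun x => u t x) J :=
  ContDiffOn.comp (g := fun p : ℝ × ℝ => u p.1 p.2) (f := fun x => (t, x)) hu
    (contDiffOn_const.prodMk contDiffOn_id) fun _ hx => ⟨ht, hx⟩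

/-- The `m × m` matrix of the derivatives `∂_x^i ∂_t^j u` with `1 ≤ i, j ≤ m`. -/
noncomputable def mixedMatrix (u : ℝ → ℝ → ℝ) (m : ℕ) (t x : ℝ) : Matrix (Fin m) (Fin m) ℝ :=
  Matrix.of fun i j => jetArray u t x (i + 1) (j + 1)

theorem det_mixedMatrix (u : ℝ → ℝ → ℝ) (m : ℕ) (t x : ℝ) :
    (mixedMatrix u m t x).det = cminor (jetArray u t x) 1 1 m := by
  simp [mixedMatrix, cminor, minor, seg, add_comm 1]

/-- If the minor of size `m + 1` vanishes and that of size `m` does not, then the row of index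
`m + 1` is a combination of the preceding ones. -/
theorem row_eq_of_cminor_eq_zero {m : ℕ} {t x : ℝ}
    (h0 : cminor (jetArray u t x) 1 1 (m + 1) = 0) (h1 : cminor (jetArray u t x) 1 1 m ≠ 0)
    {j : ℕ} (hj : j ≤ m) :
    ∑ i : Fin m, jetArray u t x (i + 1) (j + 1)
        * ((mixedMatrix u m t x).transpose⁻¹.mulVec fun k => jetArray u t x (m + 1) (k + 1)) i
      = jetArray u t x (m + 1) (j + 1) := by
  have hdet : (mixedMatrix u m t x).transpose.det ≠ 0 := by
    rwa [Matrix.det_transpose, det_mixedMatrix]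
  rcases hj.lt_or_eq with hj | rfl
  · have h2 : (mixedMatrix u m t x).transpose.mulVec
        ((mixedMatrix u m t x).transpose⁻¹.mulVec fun k => jetArray u t x (m + 1) (k + 1))
        = fun k : Fin m => jetArray u t x (m + 1) (k + 1) := by
      rw [Matrix.mulVec_mulVec, Matrix.mul_nonsing_inv _ hdet.isUnit, Matrix.one_mulVec]
    exact congrFun h2 ⟨j, hj⟩
  -- The last column is not part of the inverted system: there the relation says that the Schur
  -- entry of the vanishing larger minor is zero.
  · have hs := minor_snoc_eq_schurEntry (jetArray u t x) (seg 1 j) (seg 1 j) h1 (1 + j) (1 + j)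
    rw [← seg_succ_eq_snoc] at hs
    have hs0 : schurEntry (jetArray u t x) (seg 1 j) (seg 1 j) (1 + j) (1 + j) = 0 :=
      (mul_eq_zero.1 (hs.symm.trans h0)).resolve_left h1
    have hm : (Matrix.of fun i k => jetArray u t x (seg 1 j i) (seg 1 j k))
        = mixedMatrix u j t x := by
      ext i k
      simp [mixedMatrix, seg, add_comm 1]
    rw [schurEntry, hm, sub_eq_zero, Matrix.dotProduct_mulVec, dotProduct_comm] at hs0
    rw [← Matrix.transpose_nonsing_inv, Matrix.mulVec_transpose]
    simp only [seg, add_comm 1] at hs0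
    exact hs0.symm

/-- Skeleton decomposition of a function whose mixed jets have constant rank `m`. -/
theorem SmoothOn₂.mixed_eq_sum (hIo : IsOpen I) (hI : I.OrdConnected) (hJo : IsOpen J)
    (hJ : J.OrdConnected) (hu : SmoothOn₂ I J u) {m : ℕ}
    (h0 : ∀ t ∈ I, ∀ x ∈ J, FSY.cminor (jetArray u t x) 1 1 (m + 1) = 0)
    (h1 : ∀ t ∈ I, ∀ x ∈ J, FSY.cminor (jetArray u t x) 1 1 m ≠ 0)
    {t₀ x₀ : ℝ} (ht₀ : t₀ ∈ I) (hx₀ : x₀ ∈ J) :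
    ∀ t ∈ I, ∀ x ∈ J, jetArray u t x 1 1 = ∑ s : Fin m, jetArray u t₀ x 1 (s + 1)
      * ((mixedMatrix u m t₀ x₀)⁻¹.mulVec fun i => jetArray u t x₀ (i + 1) 1) s := by
  have hdet : ∀ t ∈ I, ∀ x ∈ J, (mixedMatrix u m t x).det ≠ 0 := fun t ht x hx => by
    rw [det_mixedMatrix]; exact h1 t ht x hx
  -- The coefficients expressing row `m + 1` through rows `1, …, m` do not depend on `t`: a
  -- `t`-derivative moves columns `1, …, m` to `2, …, m + 1`, where the same relation holds.
  have hA : ∀ x ∈ J, ∀ t ∈ I,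
      ((mixedMatrix u m t x).transpose⁻¹.mulVec fun k => jetArray u t x (m + 1) (k + 1))
      = ((mixedMatrix u m t₀ x).transpose⁻¹.mulVec fun k => jetArray u t₀ x (m + 1) (k + 1)) := by
    intro x hx t ht
    refine inv_mulVec_eq_of_deriv hIo hI (M := fun t => (mixedMatrix u m t x).transpose)
      (M' := fun t => Matrix.of fun j i => jetArray u t x (i + 1) (j + 1 + 1))
      (y := fun t k => jetArray u t x (m + 1) (k + 1))
      (y' := fun t k => jetArray u t x (m + 1) (k + 1 + 1))
      (fun t ht j i => hu.hasDerivAt_jetArray_fst hIo hJo ht hx _ _)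
      (fun t ht k => hu.hasDerivAt_jetArray_fst hIo hJo ht hx _ _)
      (fun t ht => by rw [Matrix.det_transpose]; exact hdet t ht x hx)
      (fun t ht => ?_) t ht t₀ ht₀
    ext j
    exact row_eq_of_cminor_eq_zero (h0 t ht x hx) (h1 t ht x hx) (j := j + 1) (by omega)
  -- The first column at `t` is a combination of the first `m` columns at `t₀`. For `i < m` this
  -- defines the coefficients; for `i = m` it follows because row `m + 1` depends on the earlier
  -- rows in the same way at `t` and at `t₀`.
  have hsol : ∀ t ∈ I, ∀ x ∈ J, ∀ i ≤ m, ∑ s : Fin m, jetArray u t₀ x (i + 1) (s + 1)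
      * ((mixedMatrix u m t₀ x)⁻¹.mulVec fun k => jetArray u t x (k + 1) 1) s
      = jetArray u t x (i + 1) 1 := by
    intro t ht x hx
    have hlt : ∀ i < m, ∑ s : Fin m, jetArray u t₀ x (i + 1) (s + 1)
        * ((mixedMatrix u m t₀ x)⁻¹.mulVec fun k => jetArray u t x (k + 1) 1) s
        = jetArray u t x (i + 1) 1 := by
      intro i hi
      have h2 : (mixedMatrix u m t₀ x).mulVec
          ((mixedMatrix u m t₀ x)⁻¹.mulVec fun k => jetArray u t x (k + 1) 1)
          = fun k : Fin m => jetArray u t x (k + 1) 1 := by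
        rw [Matrix.mulVec_mulVec, Matrix.mul_nonsing_inv _ (hdet t₀ ht₀ x hx).isUnit,
          Matrix.one_mulVec]
      exact congrFun h2 ⟨i, hi⟩
    intro i hi
    rcases hi.lt_or_eq with hi | rfl
    · exact hlt i hi
    have h3 := row_eq_of_cminor_eq_zero (h0 t ht x hx) (h1 t ht x hx) (Nat.zero_le i)
    rw [hA x hx t ht] at h3
    simp only [zero_add] at h3
    have h4 := fun s : Fin i =>
      row_eq_of_cminor_eq_zero (h0 t₀ ht₀ x hx) (h1 t₀ ht₀ x hx) s.2.le
    generalize (mixedMatrix u i t₀ x).transpose⁻¹.mulVec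
      (fun k => jetArray u t₀ x (i + 1) (k + 1)) = c at h3 h4
    rw [← h3]
    simp only [← h4]
    simp only [Finset.sum_mul]
    rw [Finset.sum_comm]
    refine Finset.sum_congr rfl fun k _ => ?_
    rw [← hlt k k.2, Finset.sum_mul]
    exact Finset.sum_congr rfl fun s _ => by ring
  -- The extra row `i = m` in `hsol` is what an `x`-derivative requires, so these coefficients do
  -- not depend on `x` either.
  have hB : ∀ t ∈ I, ∀ x ∈ J,
      ((mixedMatrix u m t₀ x)⁻¹.mulVec fun k => jetArray u t x (k + 1) 1)
      = ((mixedMatrix u m t₀ x₀)⁻¹.mulVec fun k => jetArray u t x₀ (k + 1) 1) := by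
    intro t ht x hx
    refine inv_mulVec_eq_of_deriv hJo hJ (M := fun x => mixedMatrix u m t₀ x)
      (M' := fun x => Matrix.of fun i j => jetArray u t₀ x (i + 1 + 1) (j + 1))
      (y := fun x k => jetArray u t x (k + 1) 1)
      (y' := fun x k => jetArray u t x (k + 1 + 1) 1)
      (fun x hx i j => hu.hasDerivAt_jetArray_snd hIo hJo ht₀ hx _ _)
      (fun x hx k => hu.hasDerivAt_jetArray_snd hIo hJo ht hx _ _)
      (fun x hx => hdet t₀ ht₀ x hx) (fun x hx => ?_) x hx x₀ hx₀
    ext i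
    exact hsol t ht x hx (i + 1) (by omega)
  intro t ht x hx
  rw [← hB t ht x hx]
  exact (hsol t ht x hx 0 (Nat.zero_le m)).symm

/-- A smooth function with vanishing mixed derivative is a sum of functions of one variable. -/
theorem SmoothOn₂.add_eq_add_of_mixed_eq_zero (hIo : IsOpen I) (hI : I.OrdConnected)
    (hJo : IsOpen J) (hJ : J.OrdConnected) (hu : SmoothOn₂ I J u)
    (h : ∀ t ∈ I, ∀ x ∈ J, FSY.partialX (FSY.partialT u) t x = 0)
    {t₀ x₀ : ℝ} (ht₀ : t₀ ∈ I) (hx₀ : x₀ ∈ J) :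
    ∀ t ∈ I, ∀ x ∈ J, u t x = u t₀ x + (u t x₀ - u t₀ x₀) := by
  have h1 : ∀ t ∈ I, ∀ x ∈ J, FSY.partialT u t x = FSY.partialT u t x₀ := fun t ht x hx =>
    hJo.is_const_of_deriv_eq_zero hJ.isPreconnected
      (fun z hz => ((hu.partialT hIo hJo).hasDerivAt_partialX hIo hJo ht
        hz).differentiableAt.differentiableWithinAt) (fun z hz => h t ht z hz) hx hx₀
  intro t ht x hx
  have hd : ∀ z ∈ I, HasDerivAt (fun z => u z x - u z x₀) 0 z := fun z hz => by
    have := (hu.hasDerivAt_partialT hIo hJo hz hx).sub (hu.hasDerivAt_partialT hIo hJo hz hx₀)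
    rwa [h1 z hz x hx, sub_self] at this
  have h2 := hIo.is_const_of_deriv_eq_zero hI.isPreconnected
    (fun z hz => (hd z hz).differentiableAt.differentiableWithinAt) (fun z hz => (hd z hz).deriv)
    ht ht₀
  linarith

theorem sum_Icc_one_eq_sum_fin (m : ℕ) (f : ℕ → ℝ) :
    ∑ s ∈ Finset.Icc 1 m, f s = ∑ s : Fin m, f (s + 1) := by
  rw [Fin.sum_univ_eq_sum_range (fun s => f (s + 1)), Finset.range_eq_Ico,
    Finset.sum_Ico_add' f 0 m 1]
  rfl

theorem SmoothOn₂.exists_separatedSum {N : ℕ} (hN : 2 ≤ N) (hIo : IsOpen I) (hI : I.OrdConnected)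
    (hJo : IsOpen J) (hJ : J.OrdConnected) (hu : SmoothOn₂ I J u)
    (h0 : ∀ t ∈ I, ∀ x ∈ J, w (N - 1) (FSY.partialX (FSY.partialT u)) t x = 0)
    (h1 : ∀ t ∈ I, ∀ x ∈ J, w (N - 2) (FSY.partialX (FSY.partialT u)) t x ≠ 0) :
    ∃ X T : ℕ → ℝ → ℝ, SmoothData N I J X T ∧ IsSeparatedSum N I J X T u := by
  obtain ⟨m, rfl⟩ : ∃ m, N = m + 2 := ⟨N - 2, by omega⟩
  rcases I.eq_empty_or_nonempty with rfl | ⟨t₀, ht₀⟩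
  · exact ⟨fun _ _ => 0, fun _ _ => 0, fun _ _ => ⟨contDiffOn_const, contDiffOn_const⟩,
      fun t ht => ht.elim⟩
  rcases J.eq_empty_or_nonempty with rfl | ⟨x₀, hx₀⟩
  · exact ⟨fun _ _ => 0, fun _ _ => 0, fun _ _ => ⟨contDiffOn_const, contDiffOn_const⟩,
      fun t ht x hx => hx.elim⟩
  have hmix := hu.mixed_eq_sum hIo hI hJo hJ (m := m)
    (fun t ht x hx => by rw [← hu.w_mixed_eq_cminor hIo hJo _ ht hx]; exact h0 t ht x hx)
    (fun t ht x hx => by rw [← hu.w_mixed_eq_cminor hIo hJo _ ht hx]; exact h1 t ht x hx) ht₀ hx₀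
  -- `Y` and `S` are antiderivatives of the factors in `hmix`: the same jets with the `x`-order,
  -- respectively the `t`-order, lowered from `1` to `0`. The remainder `g` below then has zero
  -- mixed derivative.
  set Y : ℕ → ℝ → ℝ := fun s x => jetArray u t₀ x 0 (s + 1) with hY
  set S : ℕ → ℝ → ℝ := fun s t => if h : s < m then
    ((mixedMatrix u m t₀ x₀)⁻¹.mulVec fun i => jetArray u t x₀ (i + 1) 0) ⟨s, h⟩ else 0 with hS
  have hYc : ∀ s, ContDiffOn ℝ ∞ (Y s) J := fun s => (hu.jet hIo hJo 0 (s + 1)).contDiffOn_snd ht₀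
  have hSc : ∀ s, ContDiffOn ℝ ∞ (S s) I := fun s => by
    by_cases h : s < m
    · simp only [hS, dif_pos h, Matrix.mulVec, dotProduct]
      exact ContDiffOn.sum fun i _ => contDiffOn_const.mul
        ((hu.jet hIo hJo (i + 1) 0).contDiffOn_fst hx₀)
    · simp only [hS, dif_neg h]
      exact contDiffOn_const
  set g : ℝ → ℝ → ℝ := fun t x => u t x - ∑ s : Fin m, Y s x * S s t with hg
  have hgs : SmoothOn₂ I J g := by
    refine ContDiffOn.sub hu (ContDiffOn.sum fun s _ => ContDiffOn.mul ?_ ?_)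
    · exact (hYc s).comp _root_.contDiffOn_snd fun p hp => hp.2
    · exact (hSc s).comp _root_.contDiffOn_fst fun p hp => hp.1
  have hSd : ∀ (s : Fin m), ∀ t ∈ I, HasDerivAt (S s)
      (((mixedMatrix u m t₀ x₀)⁻¹.mulVec fun i => jetArray u t x₀ (i + 1) 1) s) t :=
    fun s t ht => by
      have : S s = fun t =>
          ∑ i, (mixedMatrix u m t₀ x₀)⁻¹ s i * jetArray u t x₀ (i + 1) 0 := by
        ext t
        simp [hS, Matrix.mulVec, dotProduct]
      rw [this]
      exact HasDerivAt.fun_sum fun i _ =>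
        (hu.hasDerivAt_jetArray_fst hIo hJo ht hx₀ (i + 1) 0).const_mul _
  have hgt : ∀ t ∈ I, ∀ x ∈ J, FSY.partialT g t x = jetArray u t x 0 1 - ∑ s : Fin m, Y s x
      * ((mixedMatrix u m t₀ x₀)⁻¹.mulVec fun i => jetArray u t x₀ (i + 1) 1) s :=
    fun t ht x hx => HasDerivAt.deriv <| (hu.hasDerivAt_jetArray_fst hIo hJo ht hx 0 0).sub <|
      HasDerivAt.fun_sum fun s _ => (hSd s t ht).const_mul _
  have hgtx : ∀ t ∈ I, ∀ x ∈ J, FSY.partialX (FSY.partialT g) t x = 0 := fun t ht x hx => by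
    rw [partialX_congr hJo hgt t ht x hx]
    have hd : HasDerivAt (fun x => jetArray u t x 0 1 - ∑ s : Fin m, Y s x
        * ((mixedMatrix u m t₀ x₀)⁻¹.mulVec fun i => jetArray u t x₀ (i + 1) 1) s)
        (jetArray u t x 1 1 - ∑ s : Fin m, jetArray u t₀ x 1 (s + 1)
        * ((mixedMatrix u m t₀ x₀)⁻¹.mulVec fun i => jetArray u t x₀ (i + 1) 1) s) x :=
      (hu.hasDerivAt_jetArray_snd hIo hJo ht hx 0 1).sub <| HasDerivAt.fun_sum fun s _ =>
        (hu.hasDerivAt_jetArray_snd hIo hJo ht₀ hx 0 (s + 1)).mul_const _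
    rw [hmix t ht x hx, sub_self] at hd
    exact hd.deriv
  have hsep := hgs.add_eq_add_of_mixed_eq_zero hIo hI hJo hJ hgtx ht₀ hx₀
  refine ⟨fun k x => if k = 0 then g t₀ x else Y (k - 1) x,
    fun k t => if k = 0 then g t x₀ - g t₀ x₀ else S (k - 1) t, fun k _ => ?_, fun t ht x hx => ?_⟩
  · by_cases hk : k = 0
    · simp only [hk, if_true]
      exact ⟨(hgs.contDiffOn_fst hx₀).sub contDiffOn_const, hgs.contDiffOn_snd ht₀⟩
    · simp only [hk, if_false]
      exact ⟨hSc _, hYc _⟩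
  · rw [Nat.add_sub_cancel, sum_Icc_one_eq_sum_fin]
    simp only [if_true, Nat.add_one_ne_zero, if_false, Nat.add_sub_cancel]
    have := hsep t ht x hx
    simp only [hg] at this ⊢
    linarith

end FSY

/-! ### The matrices `α` and `β` as jets of a separated sum. -/

namespace FSY

theorem hasDerivAt_iteratedDeriv {K : Set ℝ} (hK : IsOpen K) {f : ℝ → ℝ} (hf : ContDiffOn ℝ ∞ f K)
    {s : ℝ} (hs : s ∈ K) (n : ℕ) :
    HasDerivAt (iteratedDeriv n f) (iteratedDeriv (n + 1) f s) s := by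
  rw [iteratedDeriv_succ]
  refine DifferentiableAt.hasDerivAt ?_
  have h1 := (hf.differentiableOn_iteratedDerivWithin (m := n)
    (by exact_mod_cast WithTop.coe_lt_top _) hK.uniqueDiffOn).differentiableAt (hK.mem_nhds hs)
  refine h1.congr_of_eventuallyEq (Filter.mem_of_superset (hK.mem_nhds hs) fun z hz => ?_)
  exact (iteratedDerivWithin_of_isOpen hK hz).symm

/-- The entry `β_{k+1,l+1}`. -/
noncomputable def betaEntry (N : ℕ) (X T : ℕ → ℝ → ℝ) (k l : ℕ) (t x : ℝ) : ℝ :=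
  (if k = 0 then iteratedDeriv l (T 0) t else 0) +
    (if l = 0 then iteratedDeriv k (X 0) x else 0) +
    ∑ s ∈ Finset.Icc 1 (N - 2), iteratedDeriv k (X s) x * iteratedDeriv l (T s) t

variable {N : ℕ} {I J : Set ℝ} {X T : ℕ → ℝ → ℝ} {u : ℝ → ℝ → ℝ}

theorem SmoothData.partialT_betaEntry (hN : 2 ≤ N) (hI : IsOpen I) (h : SmoothData N I J X T)
    (l : ℕ) : ∀ t ∈ I, ∀ x ∈ J,
      partialT (betaEntry N X T 0 l) t x = betaEntry N X T 0 (l + 1) t x := by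
  intro t ht x _
  refine HasDerivAt.deriv ?_
  unfold betaEntry
  have h1 := ((hasDerivAt_iteratedDeriv hI (h 0 hN).1 ht l).add_const
    (if l = 0 then iteratedDeriv 0 (X 0) x else 0)).add <|
    HasDerivAt.fun_sum (u := Finset.Icc 1 (N - 2)) fun s hs =>
      (hasDerivAt_iteratedDeriv hI (h s (by rw [Finset.mem_Icc] at hs; omega)).1 ht l).const_mul
        (iteratedDeriv 0 (X s) x)
  simpa using! h1

theorem SmoothData.partialX_betaEntry (hN : 2 ≤ N) (hJ : IsOpen J) (h : SmoothData N I J X T)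
    (k l : ℕ) : ∀ t ∈ I, ∀ x ∈ J,
      partialX (betaEntry N X T k l) t x = betaEntry N X T (k + 1) l t x := by
  intro t _ x hx
  refine HasDerivAt.deriv ?_
  unfold betaEntry
  have h0 : HasDerivAt (fun ξ => if l = 0 then iteratedDeriv k (X 0) ξ else 0)
      (if l = 0 then iteratedDeriv (k + 1) (X 0) x else 0) x := by
    split_ifs
    · exact hasDerivAt_iteratedDeriv hJ (h 0 hN).2 hx k
    · exact hasDerivAt_const x 0
  have h1 := (h0.const_add (if k = 0 then iteratedDeriv l (T 0) t else 0)).add <|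
    HasDerivAt.fun_sum (u := Finset.Icc 1 (N - 2)) fun s hs =>
      (hasDerivAt_iteratedDeriv hJ (h s (by rw [Finset.mem_Icc] at hs; omega)).2 hx k).mul_const
        (iteratedDeriv l (T s) t)
  simpa using! h1

/-- An `x`-derivative kills `T_0` and a `t`-derivative kills `X_0`. Hence `β` is the jet matrix of
`u` from order `(0,0)`, and `α`, where both are gone, the one from order `(1,1)`. -/
theorem SmoothData.jet_eq_betaEntry (hN : 2 ≤ N) (hI : IsOpen I) (hJ : IsOpen J)
    (h : SmoothData N I J X T) (hu : IsSeparatedSum N I J X T u) (k l : ℕ) :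
    ∀ t ∈ I, ∀ x ∈ J, jet u k l t x = betaEntry N X T k l t x := by
  induction k with
  | zero =>
    induction l with
    | zero =>
      intro t ht x hx
      simp [jet, betaEntry, hu t ht x hx, add_comm (X 0 x)]
    | succ l ih =>
      intro t ht x hx
      rw [← h.partialT_betaEntry hN hI l t ht x hx, ← partialT_congr hI ih t ht x hx]
      simp [jet, Function.iterate_succ_apply']
  | succ k ih =>
    intro t ht x hx
    rw [← partialX_jet, partialX_congr hJ ih t ht x hx, h.partialX_betaEntry hN hJ k l t ht x hx]

theorem SmoothData.det_beta_eq_cminor (hN : 2 ≤ N) (hI : IsOpen I) (hJ : IsOpen J)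
    (h : SmoothData N I J X T) (hu : IsSeparatedSum N I J X T u) (n : ℕ) {t x : ℝ} (ht : t ∈ I)
    (hx : x ∈ J) : (beta N X T n t x).det = cminor (jetArray u t x) 0 0 n := by
  unfold cminor minor beta
  congr 1
  ext i j
  simp only [Matrix.of_apply, seg, zero_add, jetArray]
  rw [h.jet_eq_betaEntry hN hI hJ hu i j t ht x hx]
  rfl

theorem SmoothData.det_alpha_eq_cminor (hN : 2 ≤ N) (hI : IsOpen I) (hJ : IsOpen J)
    (h : SmoothData N I J X T) (hu : IsSeparatedSum N I J X T u) (n : ℕ) {t x : ℝ} (ht : t ∈ I)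
    (hx : x ∈ J) : (alpha N X T (n + 1) t x).det = cminor (jetArray u t x) 1 1 n := by
  unfold cminor minor alpha
  congr 1
  ext i j
  simp only [Matrix.of_apply, seg, add_comm 1, jetArray]
  rw [h.jet_eq_betaEntry hN hI hJ hu (i + 1) (j + 1) t ht x hx]
  simp [betaEntry]

/-- The matrix of size `N - 1` factors through dimension `N - 2`, so it cannot have full rank. -/
theorem det_alpha_self (hN : 2 ≤ N) (X T : ℕ → ℝ → ℝ) (t x : ℝ) : (alpha N X T N t x).det = 0 := by
  obtain ⟨m, rfl⟩ : ∃ m, N = m + 2 := ⟨N - 2, by omega⟩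
  set A : Matrix (Fin (m + 2 - 1)) (Fin m) ℝ :=
    Matrix.of fun i s => iteratedDeriv (i + 1) (X (s + 1)) x
  set B : Matrix (Fin m) (Fin (m + 2 - 1)) ℝ :=
    Matrix.of fun s j => iteratedDeriv (j + 1) (T (s + 1)) t
  have hAB : alpha (m + 2) X T (m + 2) t x = A * B := by
    ext i j
    simp only [alpha, Matrix.of_apply, Nat.add_sub_cancel, sum_Icc_one_eq_sum_fin, Matrix.mul_apply,
      A, B]
  by_contra hne
  have h1 := Matrix.rank_of_isUnit _ ((Matrix.isUnit_iff_isUnit_det _).2 (Ne.isUnit hne))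
  rw [hAB] at h1
  have h2 := (Matrix.rank_mul_le_left A B).trans (Matrix.rank_le_card_width A)
  rw [h1] at h2
  simp at h2

theorem SmoothData.smoothOn₂_separatedSum (hN : 2 ≤ N) (h : SmoothData N I J X T)
    (hu : IsSeparatedSum N I J X T u) : SmoothOn₂ I J u := by
  have hX : ∀ s, s + 2 ≤ N → SmoothOn₂ I J fun _ x => X s x := fun s hs =>
    (h s hs).2.comp contDiffOn_snd fun p hp => hp.2
  have hT : ∀ s, s + 2 ≤ N → SmoothOn₂ I J fun t _ => T s t := fun s hs =>
    (h s hs).1.comp contDiffOn_fst fun p hp => hp.1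
  refine SmoothOn₂.congr (u := fun t x => X 0 x + T 0 t
    + ∑ s ∈ Finset.Icc 1 (N - 2), X s x * T s t) ?_ hu
  refine ContDiffOn.add (ContDiffOn.add (hX 0 hN) (hT 0 hN)) (ContDiffOn.sum fun s hs => ?_)
  rw [Finset.mem_Icc] at hs
  exact ContDiffOn.mul (hX s (by omega)) (hT s (by omega))

variable {v : ℕ → ℝ → ℝ → ℝ} {a : ℝ}

/-- The consecutive differences of the candidate solution. -/
theorem mul_candidate_sub {n : ℕ} {t x : ℝ} (h0 : cminor (jetArray u t x) 0 0 (n + 1) ≠ 0)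
    (h1 : cminor (jetArray u t x) 0 0 (n + 2) ≠ 0) :
    cminor (jetArray u t x) 0 0 (n + 2) * cminor (jetArray u t x) 0 0 (n + 1)
        * (candidate u a (n + 1) t x - candidate u a n t x)
      = cminor (jetArray u t x) 1 0 (n + 1) * cminor (jetArray u t x) 0 1 (n + 1) := by
  rw [← cminor_jacobi]
  unfold candidate
  field_simp
  ring

/-- The same relation for the last index, where the numerator of the next candidate vanishes. -/
theorem mul_boundary_sub {n : ℕ} {t x : ℝ} (h0 : cminor (jetArray u t x) 0 0 (n + 1) ≠ 0) :
    cminor (jetArray u t x) 0 0 (n + 2) * cminor (jetArray u t x) 0 0 (n + 1)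
        * (a - candidate u a n t x)
      = cminor (jetArray u t x) 1 0 (n + 1) * cminor (jetArray u t x) 0 1 (n + 1)
        - cminor (jetArray u t x) 1 1 (n + 1) * cminor (jetArray u t x) 0 0 (n + 1) := by
  rw [← cminor_jacobi]
  unfold candidate
  field_simp
  ring

end FSY

/-! ### The lattice equation as a recursion, and both directions of the theorem. -/

namespace FSY

variable {N : ℕ} {I J : Set ℝ} {X T : ℕ → ℝ → ℝ} {u : ℝ → ℝ → ℝ} {v : ℕ → ℝ → ℝ → ℝ} {a : ℝ}

/-- For a candidate solution, the lattice equation at index `n + 1` determines the next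
difference. -/
theorem SmoothOn₂.latticeEq_iff (hI : IsOpen I) (hJ : IsOpen J) (hu : SmoothOn₂ I J u) {n : ℕ}
    (hτ : ∀ t ∈ I, ∀ x ∈ J, FSY.cminor (jetArray u t x) 0 0 (n + 1) ≠ 0)
    (hv : ∀ t ∈ I, ∀ x ∈ J, v (n + 1) t x = FSY.candidate u a n t x)
    {t x : ℝ} (ht : t ∈ I) (hx : x ∈ J) (hτ0 : FSY.cminor (jetArray u t x) 0 0 n ≠ 0)
    (hd : FSY.cminor (jetArray u t x) 0 0 (n + 1) * FSY.cminor (jetArray u t x) 0 0 n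
        * (v (n + 1) t x - v n t x)
      = FSY.cminor (jetArray u t x) 1 0 n * FSY.cminor (jetArray u t x) 0 1 n)
    (hne : v n t x ≠ v (n + 1) t x) (hne' : v (n + 1) t x ≠ v (n + 2) t x) :
    LatticeEq v (n + 1) t x ↔
      FSY.cminor (jetArray u t x) 0 0 (n + 2) * FSY.cminor (jetArray u t x) 0 0 (n + 1)
        * (v (n + 2) t x - v (n + 1) t x)
      = FSY.cminor (jetArray u t x) 1 0 (n + 1) * FSY.cminor (jetArray u t x) 0 1 (n + 1) := by
  unfold LatticeEq
  have hT := partialT_congr hI hv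
  rw [partialX_congr hJ hT t ht x hx, hT t ht x hx, partialX_congr hJ hv t ht x hx,
    hu.mixed_candidate hI hJ hτ t ht x hx, hu.partialT_candidate hI hJ ht hx (hτ t ht x hx),
    hu.partialX_candidate hI hJ ht hx (hτ t ht x hx), Nat.add_sub_cancel]
  have hτ1 := hτ t ht x hx
  have hb : v (n + 1) t x - v n t x ≠ 0 := sub_ne_zero.2 hne.symm
  have hc : v (n + 1 + 1) t x - v (n + 1) t x ≠ 0 := sub_ne_zero.2 hne'.symm
  change _ ↔ FSY.cminor (jetArray u t x) 0 0 (n + 2) * FSY.cminor (jetArray u t x) 0 0 (n + 1)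
    * (v (n + 1 + 1) t x - v (n + 1) t x) = _
  generalize v (n + 1) t x - v n t x = b at *
  generalize v (n + 1 + 1) t x - v (n + 1) t x = c at *
  have hpq := mul_ne_zero (mul_ne_zero hτ1 hτ0) hb
  rw [hd] at hpq
  generalize FSY.cminor (jetArray u t x) 0 0 (n + 1) = τ₁ at *
  generalize FSY.cminor (jetArray u t x) 0 0 n = τ₀ at *
  generalize FSY.cminor (jetArray u t x) 0 0 (n + 2) = τ₂ at *
  generalize FSY.cminor (jetArray u t x) 1 0 n = p₀ at *
  generalize FSY.cminor (jetArray u t x) 0 1 n = q₀ at *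
  generalize FSY.cminor (jetArray u t x) 1 0 (n + 1) = p₁ at *
  generalize FSY.cminor (jetArray u t x) 0 1 (n + 1) = q₁ at *
  have hb' : b = p₀ * q₀ / (τ₁ * τ₀) := by
    rw [eq_div_iff (mul_ne_zero hτ1 hτ0)]; linarith
  obtain ⟨hp, hq⟩ := mul_ne_zero_iff.1 hpq
  -- The two sides of the lattice equation differ by a multiple of the defect of the next difference
  -- formula. The factor is nonzero since `v_n ≠ v_{n+1}` forces `p₀ q₀ ≠ 0`.
  have key : (q₁ * p₁ * τ₀ - p₀ * q₀ * τ₂) / τ₁ ^ 3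
      - -(p₀ * q₁) / τ₁ ^ 2 * (-(q₀ * p₁) / τ₁ ^ 2) * (1 / b - 1 / c)
      = p₀ * q₀ / (τ₁ ^ 4 * c) * (p₁ * q₁ - τ₂ * τ₁ * c) := by
    rw [hb']
    field_simp
    ring
  rw [← sub_eq_zero, key, mul_eq_zero, or_iff_right (by positivity), sub_eq_zero, eq_comm]

theorem SmoothData.isGivenBy_iff (hN : 2 ≤ N) (hI : IsOpen I) (hJ : IsOpen J)
    (h : SmoothData N I J X T) (hu : IsSeparatedSum N I J X T u) :
    IsGivenBy N a I J X T v ↔ ∀ n, n + 2 ≤ N → ∀ t ∈ I, ∀ x ∈ J,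
      cminor (jetArray u t x) 0 0 (n + 1) ≠ 0 ∧ v (n + 1) t x = candidate u a n t x := by
  constructor
  · intro hg n hn t ht x hx
    have := hg (n + 1) (by omega) (by omega) t ht x hx
    rwa [h.det_alpha_eq_cminor hN hI hJ hu n ht hx,
      h.det_beta_eq_cminor hN hI hJ hu (n + 1) ht hx] at this
  · intro hg n hn1 hn t ht x hx
    obtain ⟨k, rfl⟩ : ∃ k, n = k + 1 := ⟨n - 1, by omega⟩
    rw [h.det_alpha_eq_cminor hN hI hJ hu k ht hx, h.det_beta_eq_cminor hN hI hJ hu (k + 1) ht hx]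
    exact hg k (by omega) t ht x hx

theorem SmoothData.isSolution_and_generic (hN : 2 ≤ N) (hI : IsOpen I) (hJ : IsOpen J)
    (h : SmoothData N I J X T) (hv : Admissible N a I J v) (hg : IsGivenBy N a I J X T v) :
    IsSolution N a I J v ∧ Generic N I J v := by
  set u : ℝ → ℝ → ℝ := fun t x => X 0 x + T 0 t + ∑ s ∈ Finset.Icc 1 (N - 2), X s x * T s t
  have hsep : IsSeparatedSum N I J X T u := fun t _ x _ => rfl
  have hu := h.smoothOn₂_separatedSum hN hsep
  rw [h.isGivenBy_iff hN hI hJ hsep] at hg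
  have hτ : ∀ n < N, ∀ t ∈ I, ∀ x ∈ J, cminor (jetArray u t x) 0 0 n ≠ 0 := by
    intro n hn t ht x hx
    rcases n with _ | n
    · rw [cminor_zero]; exact one_ne_zero
    · exact (hg n (by omega) t ht x hx).1
  have hdiff : ∀ n < N, ∀ t ∈ I, ∀ x ∈ J,
      cminor (jetArray u t x) 0 0 (n + 1) * cminor (jetArray u t x) 0 0 n
        * (v (n + 1) t x - v n t x)
      = cminor (jetArray u t x) 1 0 n * cminor (jetArray u t x) 0 1 n := by
    intro n hn t ht x hx
    rcases n with _ | n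
    · have h1 := hτ 1 (by omega) t ht x hx
      rw [(hg 0 hN t ht x hx).2, hv.left t ht x hx, candidate]
      simp only [cminor_zero, zero_add]
      field_simp
      ring
    · rw [(hg n (by omega) t ht x hx).2]
      rcases (show n + 2 ≤ N by omega).lt_or_eq with hn' | rfl
      · rw [(hg (n + 1) (by omega) t ht x hx).2]
        exact mul_candidate_sub (hτ _ (by omega) t ht x hx) (hτ _ (by omega) t ht x hx)
      -- At the right end the general formula has the extra term `σ_{N-1} τ_{N-1}`, which vanishes
      -- by `det_alpha_self`; `τ_N` itself may be zero.
      · rw [hv.right t ht x hx, mul_boundary_sub (hτ _ hn t ht x hx),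
          ← h.det_alpha_eq_cminor hN hI hJ hsep (n + 1) ht hx, det_alpha_self hN]
        ring
  -- Distinct neighbours make `p_n q_n` nonzero, and these are the factors in the numerators of the
  -- first derivatives; genericity follows.
  have hpq : ∀ n, n + 1 < N → ∀ t ∈ I, ∀ x ∈ J,
      cminor (jetArray u t x) 1 0 n ≠ 0 ∧ cminor (jetArray u t x) 0 1 n ≠ 0 := by
    intro n hn t ht x hx
    rw [← mul_ne_zero_iff, ← hdiff n (by omega) t ht x hx]
    exact mul_ne_zero (mul_ne_zero (hτ _ hn t ht x hx) (hτ _ (by omega) t ht x hx))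
      (sub_ne_zero.2 (hv.ne n (by omega) t ht x hx).symm)
  refine ⟨⟨hv, fun n hn => ?_, fun n hn1 hn t ht x hx => ?_⟩, fun n hn1 hn t ht x hx => ?_⟩
  · have hconst : SmoothOn₂ I J fun _ _ => a := contDiffOn_const
    rcases n with _ | n
    · exact hconst.congr hv.left
    rcases hn.lt_or_eq with hn | hn
    · exact (hu.candidate (a := a) hI hJ (hτ (n + 1) hn)).congr
        fun t ht x hx => (hg n (by omega) t ht x hx).2
    · exact hconst.congr (hn ▸ hv.right)
  · obtain ⟨k, rfl⟩ : ∃ k, n = k + 1 := ⟨n - 1, by omega⟩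
    exact (hu.latticeEq_iff hI hJ (hτ (k + 1) (by omega))
      (fun t ht x hx => (hg k (by omega) t ht x hx).2) ht hx (hτ k (by omega) t ht x hx)
      (hdiff k (by omega) t ht x hx) (hv.ne k (by omega) t ht x hx)
      (hv.ne (k + 1) (by omega) t ht x hx)).2 (hdiff (k + 1) (by omega) t ht x hx)
  · obtain ⟨k, rfl⟩ : ∃ k, n = k + 1 := ⟨n - 1, by omega⟩
    have hvk := fun t ht x hx => (hg k (by omega) t ht x hx).2
    have h0 := hτ (k + 1) (by omega) t ht x hx
    have hk := hpq k (by omega) t ht x hx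
    have hk' := hpq (k + 1) (by omega) t ht x hx
    rw [partialT_congr hI hvk t ht x hx, partialX_congr hJ hvk t ht x hx,
      hu.partialT_candidate hI hJ ht hx h0, hu.partialX_candidate hI hJ ht hx h0]
    exact ⟨div_ne_zero (neg_ne_zero.2 (mul_ne_zero hk.1 hk'.2)) (pow_ne_zero 2 h0),
      div_ne_zero (neg_ne_zero.2 (mul_ne_zero hk.2 hk'.1)) (pow_ne_zero 2 h0)⟩

theorem IsSolution.exists_isGivenBy (hN : 2 ≤ N) (hIo : IsOpen I) (hI : I.OrdConnected)
    (hJo : IsOpen J) (hJ : J.OrdConnected) (hv : IsSolution N a I J v) (hgen : Generic N I J v) :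
    ∃ X T : ℕ → ℝ → ℝ, SmoothData N I J X T ∧ IsGivenBy N a I J X T v := by
  have hva : ∀ t ∈ I, ∀ x ∈ J, v 1 t x - a ≠ 0 := fun t ht x hx => by
    rw [← hv.left t ht x hx]
    exact sub_ne_zero.2 (hv.ne 0 (by omega) t ht x hx).symm
  -- Forced by the formula for `n = 1`, where `det α` is the empty determinant: `v_1 = 1/u + a`.
  set u : ℝ → ℝ → ℝ := fun t x => (v 1 t x - a)⁻¹ with hu_def
  have hu : SmoothOn₂ I J u :=
    (ContDiffOn.sub (hv.smooth 1 (by omega)) contDiffOn_const).inv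
      fun p hp => hva p.1 hp.1 p.2 hp.2
  have hτ1 : ∀ t x, cminor (jetArray u t x) 0 0 1 = (v 1 t x - a)⁻¹ := fun t x => by
    simp [cminor, minor, jetArray, jet, seg, hu_def]
  have main : ∀ n, n + 2 ≤ N → ∀ t ∈ I, ∀ x ∈ J,
      cminor (jetArray u t x) 0 0 n ≠ 0 ∧ cminor (jetArray u t x) 0 0 (n + 1) ≠ 0 ∧
      v (n + 1) t x = candidate u a n t x ∧
      cminor (jetArray u t x) 0 0 (n + 1) * cminor (jetArray u t x) 0 0 n
        * (v (n + 1) t x - v n t x)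
      = cminor (jetArray u t x) 1 0 n * cminor (jetArray u t x) 0 1 n := by
    intro n
    induction n with
    | zero =>
      intro _ t ht x hx
      have h1 := hva t ht x hx
      rw [candidate, zero_add, hτ1, hv.left t ht x hx]
      simp [cminor_zero, h1]
    | succ n ih =>
      intro hn t ht x hx
      specialize ih (by omega)
      obtain ⟨h0, h1, hvn, hd⟩ := ih t ht x hx
      have hd' := (hu.latticeEq_iff hIo hJo (fun t ht x hx => (ih t ht x hx).2.1)
        (fun t ht x hx => (ih t ht x hx).2.2.1) ht hx h0 hd (hv.ne n (by omega) t ht x hx)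
        (hv.ne (n + 1) (by omega) t ht x hx)).1 (hv.eqn (n + 1) (by omega) (by omega) t ht x hx)
      have hg := hgen (n + 1) (by omega) hn t ht x hx
      rw [partialT_congr hIo (fun t ht x hx => (ih t ht x hx).2.2.1) t ht x hx,
        partialX_congr hJo (fun t ht x hx => (ih t ht x hx).2.2.1) t ht x hx,
        hu.partialT_candidate hIo hJo ht hx h1, hu.partialX_candidate hIo hJo ht hx h1] at hg
      -- Genericity enters here: `q_{n+1}` divides `∂_t v_{n+1}` and `p_{n+1}` divides `∂_x
      -- v_{n+1}`. The difference formula then excludes `τ_{n+2} = 0`.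
      have hq : cminor (jetArray u t x) 0 1 (n + 1) ≠ 0 := fun h => hg.1 (by simp [h])
      have hp : cminor (jetArray u t x) 1 0 (n + 1) ≠ 0 := fun h => hg.2 (by simp [h])
      have h2 : cminor (jetArray u t x) 0 0 (n + 2) ≠ 0 := fun h => by
        rw [h, zero_mul, zero_mul] at hd'
        exact mul_ne_zero hp hq hd'.symm
      refine ⟨h1, h2, ?_, hd'⟩
      have hc := hd'.trans (mul_candidate_sub (a := a) h1 h2).symm
      have := mul_left_cancel₀ (mul_ne_zero h2 h1) hc
      rw [hvn] at this
      linarith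
  obtain ⟨m, rfl⟩ : ∃ m, N = m + 2 := ⟨N - 2, by omega⟩
  have hσ1 : ∀ t ∈ I, ∀ x ∈ J, cminor (jetArray u t x) 1 1 m ≠ 0 := fun t ht x hx h => by
    refine hv.ne (m + 1) (by omega) t ht x hx ?_
    rw [(main m le_rfl t ht x hx).2.2.1, hv.right t ht x hx, candidate, h]
    simp
  -- The equation at `N - 1`, for which genericity gives nothing, supplies the difference formula
  -- with `v_N = a`; compared with `mul_boundary_sub` it leaves `σ_{N-1} τ_{N-1} = 0`.
  have hσ0 : ∀ t ∈ I, ∀ x ∈ J, cminor (jetArray u t x) 1 1 (m + 1) = 0 := fun t ht x hx => by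
    obtain ⟨h0, h1, hvm, hd⟩ := main m le_rfl t ht x hx
    have hd' := (hu.latticeEq_iff hIo hJo (fun t ht x hx => (main m le_rfl t ht x hx).2.1)
      (fun t ht x hx => (main m le_rfl t ht x hx).2.2.1) ht hx h0 hd
      (hv.ne m (by omega) t ht x hx)
      (hv.ne (m + 1) (by omega) t ht x hx)).1 (hv.eqn (m + 1) (by omega) (by omega) t ht x hx)
    rw [hv.right t ht x hx, hvm, mul_boundary_sub h1, sub_eq_self] at hd'
    exact (mul_eq_zero.1 hd').resolve_right h1
  obtain ⟨X, T, hXT, hsep⟩ := hu.exists_separatedSum hN hIo hI hJo hJ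
    (fun t ht x hx => by rw [hu.w_mixed_eq_cminor hIo hJo _ ht hx]; exact hσ0 t ht x hx)
    (fun t ht x hx => by rw [hu.w_mixed_eq_cminor hIo hJo _ ht hx]; exact hσ1 t ht x hx)
  refine ⟨X, T, hXT, (hXT.isGivenBy_iff hN hIo hJo hsep).2 fun n hn t ht x hx => ?_⟩
  exact ⟨(main n hn t ht x hx).2.1, (main n hn t ht x hx).2.2.1⟩

theorem SmoothData.w_mixed_eq_zero (hN : 2 ≤ N) (hI : IsOpen I) (hJ : IsOpen J)
    (h : SmoothData N I J X T) (hsep : IsSeparatedSum N I J X T u) {t x : ℝ} (ht : t ∈ I)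
    (hx : x ∈ J) : w (N - 1) (partialX (partialT u)) t x = 0 := by
  rw [(h.smoothOn₂_separatedSum hN hsep).w_mixed_eq_cminor hI hJ _ ht hx,
    ← h.det_alpha_eq_cminor hN hI hJ hsep _ ht hx, Nat.sub_add_cancel (by omega),
    det_alpha_self hN]

end FSY

theorem mainTheorem6 (N : ℕ) (hN : 2 ≤ N) (a : ℝ) (I J : Set ℝ)
    (hIo : IsOpen I) (hI : I.OrdConnected) (hJo : IsOpen J) (hJ : J.OrdConnected) :
    -- every choice of the functions `X_s`, `T_s` gives a solution
    (∀ X T : ℕ → ℝ → ℝ, FSY.SmoothData N I J X T →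
      -- the formula for `n = N` has numerator zero, in accordance with `v_N = a`
      (∀ t ∈ I, ∀ x ∈ J, (FSY.alpha N X T N t x).det = 0) ∧
      ∀ v : ℕ → ℝ → ℝ → ℝ, FSY.Admissible N a I J v → FSY.IsGivenBy N a I J X T v →
        FSY.IsSolution N a I J v ∧ FSY.Generic N I J v) ∧
    -- every generic solution arises in this way
    (∀ v : ℕ → ℝ → ℝ → ℝ, FSY.IsSolution N a I J v → FSY.Generic N I J v →
      ∃ X T : ℕ → ℝ → ℝ, FSY.SmoothData N I J X T ∧ FSY.IsGivenBy N a I J X T v) ∧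
    -- the general solution of `w_{N-1}(u_{tx}) = 0`
    (∀ u : ℝ → ℝ → ℝ, FSY.SmoothOn₂ I J u →
      (∀ X T : ℕ → ℝ → ℝ, FSY.SmoothData N I J X T → FSY.IsSeparatedSum N I J X T u →
        ∀ t ∈ I, ∀ x ∈ J, FSY.w (N - 1) (FSY.partialX (FSY.partialT u)) t x = 0) ∧
      ((∀ t ∈ I, ∀ x ∈ J, FSY.w (N - 1) (FSY.partialX (FSY.partialT u)) t x = 0) →
        (∀ t ∈ I, ∀ x ∈ J, FSY.w (N - 2) (FSY.partialX (FSY.partialT u)) t x ≠ 0) →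
        ∃ X T : ℕ → ℝ → ℝ, FSY.SmoothData N I J X T ∧ FSY.IsSeparatedSum N I J X T u)) := by
  refine ⟨fun X T h => ⟨fun t _ x _ => FSY.det_alpha_self hN X T t x, fun v hv hg =>
    h.isSolution_and_generic hN hIo hJo hv hg⟩, fun v hv hg =>
    hv.exists_isGivenBy hN hIo hI hJo hJ hg, fun u hu => ⟨fun X T h hsep t ht x hx =>
    h.w_mixed_eq_zero hN hIo hJo hsep ht hx, fun h0 h1 =>
    hu.exists_separatedSum hN hIo hI hJo hJ h0 h1⟩⟩
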